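/- **Setting.** Let $n$ be a positive integer. Let $\mathrm{Cvx}_0(\mathbb R^n)$ be the class of lower semicontinuous convex functions $\varphi:\mathbb R^n\to[0,\infty]$ with $\varphi(0)=0$, and let $\overline{\mathrm{Cvx}}_0(\mathbb R^n)$ be the class of those $\varphi\in\mathrm{Cvx}_0(\mathbb R^n)$ with $0<\int_{\mathbb R^n}e^{-\varphi}<\infty$. For $\varphi\in\mathrm{Cvx}_0(\mathbb R^n)$ let $$(\mathcal L\varphi)(y)=\sup_{x\in\mathbb R^n}\big(\langle x,y\rangle-\varphi(x)\big),\qquad (\mathcal A\varphi)(y)=\sup_{x\in\mathbb R^n}\frac{\langle x,y\rangle-1}{\varphi(x)}$$ be the Legendre and polarity transforms, where the second supremum is taken in $[0,\infty]$, a term with $\varphi(x)=0$ counts as $+\infty$ if $\langle x,y\rangle>1$ and is omitted otherwise, and a term with $\varphi(x)=\infty$ counts as $0$. For $\alpha>0$ put $$\mathcal J_\alpha^l\varphi=\alpha\,\mathcal A\mathcal L\varphi,\qquad \mathcal R_{\mathcal J_\alpha^l}(\varphi)=\frac{\int_{\mathbb R^n}e^{-\mathcal J_\alpha^l\varphi}}{\int_{\mathbb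 R^n}e^{-\varphi}}\quad\text{for }\varphi\in\overline{\mathrm{Cvx}}_0(\mathbb R^n).$$ Let $\mathcal K_0(\mathbb R^n)$ be the family of compact convex sets in $\mathbb R^n$ that contain the origin in their interior, let $\|\cdot\|_K$ be the Minkowski functional of $K\in\mathcal K_0(\mathbb R^n)$, and let $1_S^\infty$ be $0$ on $S$ and $+\infty$ off $S$. For $K\in\mathcal K_0(\mathbb R^n)$, $r\in[0,1]$ and $t_0>0$ put $$\psi_{K,0,t_0}=\max\{\|\cdot\|_K,\,1^\infty_{t_0K}\},\qquad \psi_{K,r,t_0}=\max\Big\{\|\cdot\|_K,\ \tfrac1r\|\cdot\|_K-\tfrac{1-r}{r}t_0\Big\}\quad(0<r\le1).$$ Finally let $\rho_n$ be the unique $\rho\in(0,\tfrac14)$ with $$\left(1-\sqrt{1-4\rho}\right)(4\rho)^{-\frac1{n+2}}e^{\sqrt{1-4\rho}}=\left(\frac{2\sqrt[n]{n!}}{n+2}\right)^{\frac n{n+2}}.$$ **Theorem 1.2.** There are universal constants $C,c>0$ such that for every positive integer $n$ and every $\alpha\in(1,\rho_n(n+2)^2)$ there are $r\in[0,1]$,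 $t_0\in(0,\infty)$ and $$1+\frac cn\le\gamma\le C\,n\sqrt n\,e^{2\alpha/n}$$ such that for every $K\in\mathcal K_0(\mathbb R^n)$ the functions $\psi_{K,r,t_0}$ and $\mathcal J_\alpha^l\psi_{K,r,t_0}$ belong to $\overline{\mathrm{Cvx}}_0(\mathbb R^n)$ and, for every $\varphi\in\overline{\mathrm{Cvx}}_0(\mathbb R^n)$, $$\mathcal R_{\mathcal J_\alpha^l}(\varphi)\le\mathcal R_{\mathcal J_\alpha^l}(\psi_{K,r,t_0})=\frac{\gamma\,n!}{\alpha^n}$$ and $$\mathcal R_{\mathcal J_\alpha^l}(\varphi)\ge\mathcal R_{\mathcal J_\alpha^l}\big(\mathcal J_\alpha^l\psi_{K,r,t_0}\big)=\frac1{\gamma\,n!}.$$ -/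

import Mathlib

open scoped ENNReal NNReal Pointwise

noncomputable section

namespace Santalo

/-! Functions `ℝⁿ → [0, ∞]` are modelled as `EuclideanSpace ℝ (Fin n) → ℝ≥0∞`. -/

/-- Geometric convex functions: lower semicontinuous convex functions from `ℝⁿ` to `[0, ∞]` that
vanish at the origin.  Convexity is `φ (a x + b y) ≤ a φ x + b φ y` for `a, b ≥ 0`, `a + b = 1`. -/
def Cvx₀ (n : ℕ) : Set (EuclideanSpace ℝ (Fin n) → ℝ≥0∞) :=
  {φ | ConvexOn ℝ≥0 Set.univ φ ∧ LowerSemicontinuous φ ∧ φ 0 = 0}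

/-- The integral `∫ e^{-φ}` over `ℝⁿ` with respect to Lebesgue measure, where `e^{-∞} = 0`. -/
def integralExpNeg {n : ℕ} (φ : EuclideanSpace ℝ (Fin n) → ℝ≥0∞) : ℝ≥0∞ :=
  ∫⁻ x, EReal.exp (-(φ x : EReal))

/-- Geometric convex functions with `0 < ∫ e^{-φ} < ∞`. -/
def Cvx₀Bar (n : ℕ) : Set (EuclideanSpace ℝ (Fin n) → ℝ≥0∞) :=
  {φ | φ ∈ Cvx₀ n ∧ 0 < integralExpNeg φ ∧ integralExpNeg φ < ∞}

/-- The Legendre transform `(ℒφ)(y) = sup_x (⟨x, y⟩ - φ x)` of a function with `φ 0 = 0`.  The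
supremum is then at least `0` (take `x = 0`), so truncating its terms at `0` does not change it;
see `coe_legendre`. -/
def legendre {n : ℕ} (φ : EuclideanSpace ℝ (Fin n) → ℝ≥0∞) (y : EuclideanSpace ℝ (Fin n)) :
    ℝ≥0∞ :=
  ⨆ x, (ENNReal.ofReal (inner ℝ x y) - φ x)

/-- For `φ 0 = 0` the Legendre transform is the usual supremum of extended reals. -/
theorem coe_legendre {n : ℕ} (φ : EuclideanSpace ℝ (Fin n) → ℝ≥0∞) (h0 : φ 0 = 0)
    (y : EuclideanSpace ℝ (Fin n)) :
    (legendre φ y : EReal) = ⨆ x, (((inner ℝ x y : ℝ) : EReal) - (φ x : EReal)) := by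
  have hnn : (0 : EReal) ≤ ⨆ x, (((inner ℝ x y : ℝ) : EReal) - (φ x : EReal)) := by
    refine le_trans ?_ (le_iSup _ (0 : EuclideanSpace ℝ (Fin n)))
    simp [h0]
  apply le_antisymm
  · rw [← EReal.coe_toENNReal hnn, EReal.coe_ennreal_le_coe_ennreal_iff]
    refine iSup_le fun x => ?_
    rw [tsub_le_iff_right]
    rcases eq_or_ne (φ x) ⊤ with hx | hx
    · simp [hx]
    · rw [← EReal.coe_ennreal_le_coe_ennreal_iff, EReal.coe_ennreal_add, EReal.coe_toENNReal hnn]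
      have h1 := le_iSup (fun x => (((inner ℝ x y : ℝ) : EReal) - (φ x : EReal))) x
      have hp : (0 : EReal) ≤ (φ x : EReal) := EReal.coe_ennreal_nonneg _
      rw [EReal.coe_ennreal_ofReal]
      have h2 : ((inner ℝ x y : ℝ) : EReal) ≤
          (⨆ x, (((inner ℝ x y : ℝ) : EReal) - (φ x : EReal))) + (φ x : EReal) := by
        refine EReal.sub_le_iff_le_add (Or.inl ?_) (Or.inl ?_) |>.1 h1
        · exact EReal.coe_ennreal_ne_bot _
        · simpa using hx
      rcases le_total (inner ℝ x y : ℝ) 0 with hi | hi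
      · rw [max_eq_right hi]
        exact add_nonneg hnn hp
      · rwa [max_eq_left hi]
  · refine iSup_le fun x => ?_
    rcases eq_or_ne (φ x) ⊤ with hx | hx
    · simp [hx]
    · refine EReal.sub_le_iff_le_add (Or.inl (EReal.coe_ennreal_ne_bot _))
        (Or.inl (by simpa using hx)) |>.2 ?_
      have h1 : ENNReal.ofReal (inner ℝ x y) ≤ legendre φ y + φ x := by
        rw [← tsub_le_iff_right]
        exact le_iSup (fun x => (ENNReal.ofReal (inner ℝ x y) - φ x)) x
      rw [← EReal.coe_ennreal_add]
      refine le_trans ?_ (EReal.coe_ennreal_le_coe_ennreal_iff.2 h1)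
      rw [EReal.coe_ennreal_ofReal]
      exact_mod_cast le_max_left _ _

/-- The polarity transform `(𝒜φ)(y) = sup_x (⟨x, y⟩ - 1) / φ x` with values in `[0, ∞]`.  The
division of `ℝ≥0∞` gives the usual conventions: if `φ x = 0`, the term is `∞` for `⟨x, y⟩ > 1` and
does not contribute for `⟨x, y⟩ ≤ 1`; if `φ x = ∞` the term is `0`. -/
def polarity {n : ℕ} (φ : EuclideanSpace ℝ (Fin n) → ℝ≥0∞) (y : EuclideanSpace ℝ (Fin n)) :
    ℝ≥0∞ :=
  ⨆ x, ENNReal.ofReal (inner ℝ x y - 1) / φ x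

/-- The scaled polarity transform `𝒜_α φ = α 𝒜φ`. -/
def polarityScaled {n : ℕ} (α : ℝ) (φ : EuclideanSpace ℝ (Fin n) → ℝ≥0∞)
    (y : EuclideanSpace ℝ (Fin n)) : ℝ≥0∞ :=
  ENNReal.ofReal α * polarity φ y

/-- The scaled gauge transform `𝒥ˡ_α = 𝒜_α ℒ`. -/
def gaugeTransform {n : ℕ} (α : ℝ) (φ : EuclideanSpace ℝ (Fin n) → ℝ≥0∞) :
    EuclideanSpace ℝ (Fin n) → ℝ≥0∞ :=
  polarityScaled α (legendre φ)

/-- The Santaló ratio `∫ e^{-𝒥ˡ_α φ} / ∫ e^{-φ}`. -/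
def santaloRatio {n : ℕ} (α : ℝ) (φ : EuclideanSpace ℝ (Fin n) → ℝ≥0∞) : ℝ≥0∞ :=
  integralExpNeg (gaugeTransform α φ) / integralExpNeg φ

open Classical in
/-- The convex indicator function of `S`: `0` on `S` and `∞` off `S`. -/
def convexIndicator {n : ℕ} (S : Set (EuclideanSpace ℝ (Fin n)))
    (x : EuclideanSpace ℝ (Fin n)) : ℝ≥0∞ :=
  if x ∈ S then 0 else ⊤

open Classical in
/-- The function `ψ_{K,r,t₀}`, where `‖·‖_K` is the Minkowski functional `gauge K`:
`max {‖·‖_K, indicator of t₀ K}` for `r = 0`, and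
`max {‖·‖_K, (1/r) ‖·‖_K - ((1-r)/r) t₀}` for `0 < r ≤ 1`. -/
def psi {n : ℕ} (K : ConvexBody (EuclideanSpace ℝ (Fin n))) (r t₀ : ℝ)
    (x : EuclideanSpace ℝ (Fin n)) : ℝ≥0∞ :=
  if r = 0 then
    max (ENNReal.ofReal (gauge (K : Set (EuclideanSpace ℝ (Fin n))) x))
      (convexIndicator (t₀ • (K : Set (EuclideanSpace ℝ (Fin n)))) x)
  else
    ENNReal.ofReal (max (gauge (K : Set (EuclideanSpace ℝ (Fin n))) x)
      (1 / r * gauge (K : Set (EuclideanSpace ℝ (Fin n))) x - (1 - r) / r * t₀))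

/-- The function `q(x) = (1 - √(1-x)) x^{-1/(n+2)} e^{√(1-x)}`. -/
def q (n : ℕ) (x : ℝ) : ℝ :=
  (1 - √(1 - x)) * x ^ (-(1 / ((n : ℝ) + 2))) * Real.exp (√(1 - x))

/-- `q` in a form that is visibly continuous at `0`. -/
theorem q_eq (n : ℕ) {x : ℝ} (hx0 : 0 ≤ x) (hx1 : x ≤ 1) :
    q n x = x ^ (1 - 1 / ((n : ℝ) + 2)) / (1 + √(1 - x)) * Real.exp (√(1 - x)) := by
  have hn : (1 : ℝ) - 1 / ((n : ℝ) + 2) ≠ 0 := by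
    have : (0 : ℝ) ≤ n := Nat.cast_nonneg n
    have : 1 / ((n : ℝ) + 2) < 1 := by rw [div_lt_one] <;> linarith
    linarith
  rcases hx0.eq_or_lt with rfl | hx
  · rw [Real.zero_rpow hn]; simp [q]
  · have hs : √(1 - x) ^ 2 = 1 - x := Real.sq_sqrt (by linarith)
    have hs0 : 0 ≤ √(1 - x) := Real.sqrt_nonneg _
    have e : x ^ (1 - 1 / ((n : ℝ) + 2)) = x * x ^ (-(1 / ((n : ℝ) + 2))) := by
      rw [sub_eq_add_neg, Real.rpow_add hx, Real.rpow_one]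
    have : 1 - √(1 - x) = x / (1 + √(1 - x)) := by
      rw [eq_div_iff (by positivity)]; nlinarith
    rw [q, e, this]; ring

/-- The logarithm of `q` after the substitution `s = √(1-x)` is strictly decreasing. -/
theorem logq_strictAnti {a : ℝ} (ha0 : 0 < a) (ha : a ≤ 1 / 2) :
    StrictAntiOn (fun s : ℝ => (1 - a) * Real.log (1 - s) - a * Real.log (1 + s) + s)
      (Set.Ico 0 1) := by
  have hd : ∀ s ∈ Set.Ico (0 : ℝ) 1, HasDerivAt
      (fun s : ℝ => (1 - a) * Real.log (1 - s) - a * Real.log (1 + s) + s)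
      ((1 - a) * (-1 / (1 - s)) - a * (1 / (1 + s)) + 1) s := by
    intro s hs
    have h1 : HasDerivAt (fun s : ℝ => 1 - s) (-1) s := by
      simpa using (hasDerivAt_id s).const_sub 1
    have h2 : HasDerivAt (fun s : ℝ => 1 + s) 1 s := by
      simpa using (hasDerivAt_id s).const_add 1
    have h3 := h1.log (by linarith [hs.2])
    have h4 := h2.log (by linarith [hs.1])
    exact ((h3.const_mul (1 - a)).sub (h4.const_mul a)).add (hasDerivAt_id s)
  refine strictAntiOn_of_deriv_neg (convex_Ico 0 1)
    (fun s hs => (hd s hs).continuousAt.continuousWithinAt) ?_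
  intro s hs
  rw [interior_Ico] at hs
  rw [(hd s ⟨hs.1.le, hs.2⟩).deriv]
  have p1 : 0 < 1 - s := by linarith [hs.2]
  have p2 : 0 < 1 + s := by linarith [hs.1]
  have : (1 - a) * (-1 / (1 - s)) - a * (1 / (1 + s)) + 1
      = -(s * (1 - 2 * a) + s ^ 2) / ((1 - s) * (1 + s)) := by
    field_simp; ring
  rw [this]
  apply div_neg_of_neg_of_pos _ (mul_pos p1 p2)
  nlinarith [mul_nonneg hs.1.le (by linarith : (0 : ℝ) ≤ 1 - 2 * a), pow_pos hs.1 2]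

theorem q_strictMono (n : ℕ) : StrictMonoOn (q n) (Set.Ioc 0 1) := by
  have hn : (0 : ℝ) ≤ n := Nat.cast_nonneg n
  set a : ℝ := 1 / ((n : ℝ) + 2) with ha
  have ha0 : 0 < a := by positivity
  have ha1 : a ≤ 1 / 2 := by
    rw [ha]; exact one_div_le_one_div_of_le (by norm_num) (by linarith)
  have key : ∀ x ∈ Set.Ioc (0 : ℝ) 1, 0 < q n x ∧ √(1 - x) ∈ Set.Ico (0 : ℝ) 1 ∧
      Real.log (q n x) = (1 - a) * Real.log (1 - √(1 - x)) - a * Real.log (1 + √(1 - x))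
        + √(1 - x) := by
    intro x hx
    have hs0 : 0 ≤ √(1 - x) := Real.sqrt_nonneg _
    have hs1 : √(1 - x) < 1 := by
      rw [Real.sqrt_lt' one_pos]; linarith [hx.1]
    have hsq : √(1 - x) ^ 2 = 1 - x := Real.sq_sqrt (by linarith [hx.2])
    have p1 : 0 < 1 - √(1 - x) := by linarith
    have p2 : 0 < 1 + √(1 - x) := by linarith
    have px : 0 < x ^ (-a) := Real.rpow_pos_of_pos hx.1 _
    refine ⟨by unfold q; positivity, ⟨hs0, hs1⟩, ?_⟩
    have hlx : Real.log x = Real.log (1 - √(1 - x)) + Real.log (1 + √(1 - x)) := by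
      rw [← Real.log_mul p1.ne' p2.ne']
      congr 1
      nlinarith
    unfold q
    rw [← ha, Real.log_mul (by positivity) (Real.exp_pos _).ne', Real.log_exp,
      Real.log_mul p1.ne' px.ne', Real.log_rpow hx.1, hlx]
    ring
  intro x hx y hy hxy
  obtain ⟨qx, sx, lx⟩ := key x hx
  obtain ⟨qy, sy, ly⟩ := key y hy
  rw [← Real.log_lt_log_iff qx qy, lx, ly]
  refine logq_strictAnti ha0 ha1 sy sx ?_
  exact Real.sqrt_lt_sqrt (by linarith [hy.2]) (by linarith)

theorem factorial_mul_two_pow_le (n : ℕ) : n.factorial * 2 ^ n ≤ (n + 1) ^ n := by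
  induction n with
  | zero => simp
  | succ n ih =>
    have hb : 2 * (n + 1) ^ (n + 1) ≤ (n + 2) ^ (n + 1) := by
      have h := one_add_mul_le_pow (a := (1 : ℝ) / (n + 1))
        (by have : (0 : ℝ) ≤ 1 / (n + 1) := by positivity
            linarith) (n + 1)
      have hp : (0 : ℝ) < n + 1 := by positivity
      have e : (1 : ℝ) + ((n + 1 : ℕ) : ℝ) * (1 / (n + 1)) = 2 := by
        push_cast; field_simp; norm_num
      rw [e] at h
      have e2 : (1 : ℝ) + 1 / (n + 1) = (n + 2) / (n + 1) := by field_simp; ring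
      rw [e2, div_pow, le_div_iff₀ (by positivity)] at h
      exact_mod_cast h
    calc (n + 1).factorial * 2 ^ (n + 1) = 2 * (n + 1) * (n.factorial * 2 ^ n) := by
          rw [Nat.factorial_succ]; ring
      _ ≤ 2 * (n + 1) * (n + 1) ^ n := Nat.mul_le_mul_left _ ih
      _ = 2 * (n + 1) ^ (n + 1) := by ring
      _ ≤ (n + 1 + 1) ^ (n + 1) := hb

/-- There is a unique `ρ ∈ (0, 1/4)` with `q(4ρ) = (2 (n!)^{1/n} / (n+2))^{n/(n+2)}`. -/
theorem existsUnique_rho (n : ℕ) (hn : 0 < n) :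
    ∃! ρ : ℝ, ρ ∈ Set.Ioo (0 : ℝ) (1 / 4) ∧
      q n (4 * ρ) =
        (2 * ((n.factorial : ℝ) ^ (1 / (n : ℝ))) / ((n : ℝ) + 2)) ^ ((n : ℝ) / ((n : ℝ) + 2)) := by
  have hn' : (0 : ℝ) < n := by exact_mod_cast hn
  set R : ℝ := (2 * ((n.factorial : ℝ) ^ (1 / (n : ℝ))) / ((n : ℝ) + 2)) ^ ((n : ℝ) / ((n : ℝ) + 2))
    with hR
  have hf : (0 : ℝ) < (n.factorial : ℝ) := by exact_mod_cast Nat.factorial_pos n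
  have hR0 : 0 < R := by
    have := Real.rpow_pos_of_pos hf (1 / (n : ℝ))
    rw [hR]; positivity
  have hR1 : R < 1 := by
    have hroot : 2 * (n.factorial : ℝ) ^ (1 / (n : ℝ)) ≤ n + 1 := by
      have h : (n.factorial : ℝ) ≤ (((n : ℝ) + 1) / 2) ^ n := by
        rw [div_pow, le_div_iff₀ (by positivity)]
        exact_mod_cast factorial_mul_two_pow_le n
      have h2 := Real.rpow_le_rpow hf.le h (z := 1 / (n : ℝ)) (by positivity)
      rw [one_div, Real.pow_rpow_inv_natCast (by positivity) hn.ne'] at h2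
      rw [one_div]; linarith
    have := Real.rpow_pos_of_pos hf (1 / (n : ℝ))
    refine Real.rpow_lt_one (by positivity) ?_ (by positivity)
    rw [div_lt_one (by positivity)]
    linarith
  have q0 : q n 0 = 0 := by simp [q]
  have q1 : q n 1 = 1 := by simp [q]
  have hc : ContinuousOn (q n) (Set.Icc 0 1) := by
    have hexp : 0 ≤ 1 - 1 / ((n : ℝ) + 2) := by
      have : 1 / ((n : ℝ) + 2) ≤ 1 := by rw [div_le_one] <;> linarith
      linarith
    have : Continuous fun x : ℝ =>
        x ^ (1 - 1 / ((n : ℝ) + 2)) / (1 + √(1 - x)) * Real.exp (√(1 - x)) := by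
      refine Continuous.mul (Continuous.div ?_ (by fun_prop) ?_) (by fun_prop)
      · exact Real.continuous_rpow_const hexp
      · intro x
        have := Real.sqrt_nonneg (1 - x)
        positivity
    exact this.continuousOn.congr fun x hx => q_eq n hx.1 hx.2
  obtain ⟨x, hx, hqx⟩ := intermediate_value_Ioo zero_le_one hc
    (show R ∈ Set.Ioo (q n 0) (q n 1) by rw [q0, q1]; exact ⟨hR0, hR1⟩)
  refine ⟨x / 4, ⟨⟨by linarith [hx.1], by linarith [hx.2]⟩, ?_⟩, ?_⟩
  · rw [show 4 * (x / 4) = x by ring]; exact hqx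
  · rintro y ⟨hy, hqy⟩
    have := (q_strictMono n).injOn (x₁ := 4 * y) (x₂ := x)
      ⟨by linarith [hy.1], by linarith [hy.2]⟩ ⟨hx.1, hx.2.le⟩ (hqy.trans hqx.symm)
    linarith

/-- The number `ρ_n`: the unique `ρ ∈ (0, 1/4)` with
`q(4ρ) = (2 (n!)^{1/n} / (n+2))^{n/(n+2)}`. -/
def rho (n : ℕ) (hn : 0 < n) : ℝ := (existsUnique_rho n hn).choose

end Santalo

end

/-! By Fenchel–Moreau, `𝒥φ(y) ≤ u` holds exactly when `φ((α/u) y) ≤ α/u` (`gaugeTransform_le_iff`).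
The sublevel sets of `𝒥φ` are therefore dilates of those of `φ`. With `V(t) = vol {φ ≤ t}`, the
denominator of the Santaló ratio is `∫ e^{-t} V(t) dt`, and the substitution `u = α/t` turns the
numerator into `∫ ν(t) V(t) dt`, where `ν(t) = α t^{-n-2} e^{-α/t}`.

In polar coordinates `V(t)` is an integral over directions of `g(t)^n / n`, with `g` nonnegative and
concave on `(0, ∞)` (or infinite on rays where `φ` vanishes). What remains is one-dimensional: the
best `M` with `∫ ν g^n ≤ M ∫ e^{-t} g^n` for all such `g`.

The quotient `w = ν e^t` increases up to `t₁`, decreases up to `t₂` and increases again, `t₁ ≤ t₂`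
being the roots of `t² - (n+2)t + α`. Hence `ν` and `M e^{-t}` cross once, or three times at `a ≤ b
< c`. In the triple case `g` is compared with the minimum `h` of the line through `0` and `(a, g a)`
and the secant over `[b, c]`: the signs of `ν - M e^{-t}` and `g - h` are opposite everywhere
(`ratioLE_of_triple_crossing`). Up to a factor `h` is `levelRadius r t₀`, the profile of
`ψ_{K,r,t₀}`, with kink in a fixed compact interval, so the optimal `M` is attained by some `ψ`
(`exists_maximizer`).

Minimizers come for free: applying `𝒥` twice multiplies integrals by `α^{-n}`, so the upper bound
applied to `𝒥φ` is a lower bound for `φ`. Finally `γ = M α^n / n!`. Testing with `min(t, ε)` bounds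
it below; above, `M ≤ w(t₁)`, which holds because `α < ρ_n (n+2)²` forces `w(t₁) ≥ 1/n!`, and
Stirling estimates `w(t₁)`. -/

noncomputable section

namespace Santalo

/-! ### Sublevel sets of the gauge transform -/

/-- Fenchel–Moreau at the level of sublevel sets: if every affine minorant coming from the Legendre
transform is at most `c` at `y`, then `φ y ≤ c`. -/
theorem le_of_forall_inner_le_legendre_add {n : ℕ} {φ : EuclideanSpace ℝ (Fin n) → ℝ≥0∞}
    (hφ : φ ∈ Cvx₀ n) {y : EuclideanSpace ℝ (Fin n)} {c : ℝ} (hc : 0 ≤ c)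
    (h : ∀ x, ENNReal.ofReal (inner ℝ x y) ≤ legendre φ x + ENNReal.ofReal c) :
    φ y ≤ ENNReal.ofReal c := by
  obtain ⟨hconv, hlsc, h0⟩ := hφ
  by_contra! hlt
  let S : Set (EuclideanSpace ℝ (Fin n) × ℝ) := {p | 0 ≤ p.2 ∧ φ p.1 ≤ ENNReal.ofReal p.2}
  have hSconv : Convex ℝ S := by
    rintro ⟨z, s⟩ ⟨hs, hz⟩ ⟨z', s'⟩ ⟨hs', hz'⟩ a b ha hb hab
    simp only at hs hz hs' hz'
    refine ⟨by simp only [Prod.snd_add, Prod.smul_snd, smul_eq_mul]; positivity, ?_⟩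
    lift a to ℝ≥0 using ha
    lift b to ℝ≥0 using hb
    have := hconv.2 (Set.mem_univ z) (Set.mem_univ z') (zero_le (a := a)) (zero_le (a := b))
      (by exact_mod_cast hab)
    refine le_trans this ?_
    simp only [Prod.snd_add, Prod.smul_snd, smul_eq_mul]
    rw [ENNReal.ofReal_add (by positivity) (by positivity), ENNReal.ofReal_mul (by positivity),
      ENNReal.ofReal_mul (by positivity), ENNReal.ofReal_coe_nnreal, ENNReal.ofReal_coe_nnreal]
    simp only [ENNReal.smul_def, smul_eq_mul]
    gcongr
  have hSclosed : IsClosed S := by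
    have h1 : IsClosed {p : EuclideanSpace ℝ (Fin n) × ℝ≥0∞ | φ p.1 ≤ p.2} :=
      hlsc.isClosed_epigraph
    have h2 : Continuous fun p : EuclideanSpace ℝ (Fin n) × ℝ => (p.1, ENNReal.ofReal p.2) :=
      continuous_fst.prodMk (ENNReal.continuous_ofReal.comp continuous_snd)
    exact (isClosed_le continuous_const continuous_snd).inter (h1.preimage h2)
  have hnot : (y, c) ∉ S := fun hm => hlt.not_ge hm.2
  obtain ⟨f, u, hu1, hu2⟩ := geometric_hahn_banach_closed_point hSconv hSclosed hnot
  let g := f.comp (ContinuousLinearMap.inl ℝ (EuclideanSpace ℝ (Fin n)) ℝ)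
  let v := (InnerProductSpace.toDual ℝ (EuclideanSpace ℝ (Fin n))).symm g
  let l := f (0, 1)
  have hf : ∀ z s, f (z, s) = inner ℝ v z + s * l := by
    intro z s
    have e : ((z, s) : EuclideanSpace ℝ (Fin n) × ℝ) = (z, 0) + s • (0, 1) := by simp
    rw [e, map_add, map_smul]
    simp [v, g, l]
  have hu0 : 0 < u := by
    have := hu1 (0, 0) ⟨le_rfl, by simp [h0]⟩
    simpa [hf] using this
  have hl : l ≤ 0 := by
    by_contra! hl
    have := hu1 (0, u / l) ⟨by simp; positivity, by simp [h0]⟩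
    rw [hf, inner_zero_right, div_mul_cancel₀ _ hl.ne'] at this
    linarith
  rw [hf] at hu2
  -- The separating hyperplane may be vertical (`l = 0`). Heights in `S` are nonnegative, so tilting
  -- it by a small `ε` keeps the separation and makes its slope finite; it then gives an affine
  -- minorant of `φ` lying above `c` at `y`.
  obtain ⟨ε, hε, hε2⟩ : ∃ ε > 0, u < inner ℝ v y + c * l - ε * c := by
    refine ⟨(inner ℝ v y + c * l - u) / (c + 1) , div_pos (by linarith) (by linarith), ?_⟩
    have : (inner ℝ v y + c * l - u) / (c + 1) * c < (inner ℝ v y + c * l - u) := by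
      rw [div_mul_eq_mul_div, div_lt_iff₀ (by linarith)]
      nlinarith
    linarith
  set m := ε - l with hm
  have hm0 : 0 < m := by linarith
  have hL : legendre φ (m⁻¹ • v) ≤ ENNReal.ofReal (u / m) := by
    refine iSup_le fun z => ?_
    rw [tsub_le_iff_right]
    rcases eq_or_ne (φ z) ⊤ with hz | hz
    · simp [hz]
    · have := hu1 (z, (φ z).toReal) ⟨ENNReal.toReal_nonneg, (ENNReal.ofReal_toReal hz).ge⟩
      rw [hf] at this
      conv_rhs => rw [← ENNReal.ofReal_toReal hz]
      rw [← ENNReal.ofReal_add (by positivity) ENNReal.toReal_nonneg]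
      refine ENNReal.ofReal_le_ofReal ?_
      rw [inner_smul_right, real_inner_comm, div_eq_inv_mul]
      have h3 : inner ℝ v z ≤ u + m * (φ z).toReal := by
        have : 0 ≤ ε * (φ z).toReal := by positivity
        rw [hm]; nlinarith
      calc m⁻¹ * inner ℝ v z ≤ m⁻¹ * (u + m * (φ z).toReal) := by gcongr
        _ = _ := by field_simp
  have h4 := (h (m⁻¹ • v)).trans (add_le_add_left hL _)
  rw [← ENNReal.ofReal_add (by positivity) hc, ENNReal.ofReal_le_ofReal_iff (by positivity),
    real_inner_smul_left] at h4
  have h5 : inner ℝ v y ≤ u + m * c := by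
    have := mul_le_mul_of_nonneg_left h4 hm0.le
    field_simp at this
    linarith
  rw [hm] at h5
  linarith

theorem inner_le_legendre_add {n : ℕ} (φ : EuclideanSpace ℝ (Fin n) → ℝ≥0∞)
    (x y : EuclideanSpace ℝ (Fin n)) :
    ENNReal.ofReal (inner ℝ x y) ≤ legendre φ x + φ y := by
  rw [← tsub_le_iff_right, real_inner_comm]
  exact le_iSup (fun z => ENNReal.ofReal (inner ℝ z x) - φ z) y

/-- Clearing denominators, the bound on the left says that `⟨x, y/u⟩ - ℒφ(x) ≤ 1/u` for every `x`,
and the supremum of these terms is `φ(y/u)` by Fenchel–Moreau. -/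
theorem polarity_legendre_le_iff {n : ℕ} {φ : EuclideanSpace ℝ (Fin n) → ℝ≥0∞}
    (hφ : φ ∈ Cvx₀ n) {u : ℝ} (hu : 0 < u) (y : EuclideanSpace ℝ (Fin n)) :
    polarity (legendre φ) y ≤ ENNReal.ofReal u ↔ φ (u⁻¹ • y) ≤ ENNReal.ofReal u⁻¹ := by
  have hu0 : ENNReal.ofReal u ≠ 0 := by simpa using hu
  have key : polarity (legendre φ) y ≤ ENNReal.ofReal u ↔
      ∀ x, ENNReal.ofReal (inner ℝ x (u⁻¹ • y)) ≤ legendre φ x + ENNReal.ofReal u⁻¹ := by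
    unfold polarity
    rw [iSup_le_iff]
    refine forall_congr' fun x => ?_
    rw [ENNReal.div_le_iff_le_mul (Or.inr ENNReal.ofReal_ne_top) (Or.inr hu0),
      ENNReal.ofReal_sub _ zero_le_one, tsub_le_iff_right, inner_smul_right,
      ENNReal.ofReal_mul (by positivity), ENNReal.ofReal_inv_of_pos hu,
      ← ENNReal.mul_le_mul_iff_right hu0 ENNReal.ofReal_ne_top (b := (ENNReal.ofReal u)⁻¹ * _),
      ← mul_assoc, mul_add, ENNReal.mul_inv_cancel hu0 ENNReal.ofReal_ne_top, one_mul,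
      ENNReal.ofReal_one]
  rw [key]
  refine ⟨le_of_forall_inner_le_legendre_add hφ (by positivity), fun h x => ?_⟩
  exact (inner_le_legendre_add φ x _).trans (by gcongr)

theorem gaugeTransform_le_iff {n : ℕ} {φ : EuclideanSpace ℝ (Fin n) → ℝ≥0∞}
    (hφ : φ ∈ Cvx₀ n) {α u : ℝ} (hα : 0 < α) (hu : 0 < u) (y : EuclideanSpace ℝ (Fin n)) :
    gaugeTransform α φ y ≤ ENNReal.ofReal u ↔ φ ((α / u) • y) ≤ ENNReal.ofReal (α / u) := by
  have hα0 : ENNReal.ofReal α ≠ 0 := by simpa using hα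
  rw [← inv_div, ← polarity_legendre_le_iff hφ (by positivity), gaugeTransform, polarityScaled,
    ENNReal.ofReal_div_of_pos hα, ENNReal.le_div_iff_mul_le (Or.inl hα0)
      (Or.inl ENNReal.ofReal_ne_top), mul_comm]

theorem convexOn_iSup_ennreal {E ι : Type*} [AddCommMonoid E] [Module ℝ≥0 E]
    {f : ι → E → ℝ≥0∞} (hf : ∀ i, ConvexOn ℝ≥0 Set.univ (f i)) :
    ConvexOn ℝ≥0 Set.univ fun x => ⨆ i, f i x := by
  refine ⟨convex_univ, fun x _ y _ a b ha hb hab => iSup_le fun i => ?_⟩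
  refine ((hf i).2 (Set.mem_univ x) (Set.mem_univ y) ha hb hab).trans ?_
  simp only [ENNReal.smul_def, smul_eq_mul]
  gcongr
  · exact le_iSup (fun i => f i x) i
  · exact le_iSup (fun i => f i y) i

theorem convexOn_mul_left_ennreal {E : Type*} [AddCommMonoid E] [Module ℝ≥0 E]
    {f : E → ℝ≥0∞} (hf : ConvexOn ℝ≥0 Set.univ f) (c : ℝ≥0∞) :
    ConvexOn ℝ≥0 Set.univ fun x => c * f x := by
  refine ⟨convex_univ, fun x hx y hy a b ha hb hab => ?_⟩
  have := mul_le_mul_right (hf.2 hx hy ha hb hab) c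
  simp only [ENNReal.smul_def, smul_eq_mul] at this ⊢
  rwa [mul_add, mul_left_comm, mul_left_comm c] at this

theorem convexOn_ofReal {E : Type*} [AddCommGroup E] [Module ℝ E]
    {f : E → ℝ} (hf : ConvexOn ℝ Set.univ f) :
    ConvexOn ℝ≥0 Set.univ fun x => ENNReal.ofReal (f x) := by
  refine ⟨convex_univ, fun x hx y hy a b ha hb hab => ?_⟩
  have := hf.2 hx hy a.2 b.2 (congrArg NNReal.toReal hab)
  refine (ENNReal.ofReal_le_ofReal this).trans (ENNReal.ofReal_add_le.trans ?_)
  simp only [smul_eq_mul, ENNReal.smul_def]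
  rw [ENNReal.ofReal_mul a.2, ENNReal.ofReal_mul b.2]
  simp

theorem lowerSemicontinuous_const_mul_ennreal (c : ℝ≥0∞) :
    LowerSemicontinuous fun z : ℝ≥0∞ => c * z := by
  -- Multiplication by `∞` is discontinuous at `0`, but its sublevel sets at finite levels are just
  -- `{0}`.
  rcases eq_or_ne c ⊤ with rfl | hc
  · rw [lowerSemicontinuous_iff_isClosed_preimage]
    intro t
    rcases eq_or_ne t ⊤ with rfl | ht
    · simp
    · convert! (isClosed_singleton (x := (0 : ℝ≥0∞))) using 1
      ext z
      by_cases hz : z = 0 <;> simp [hz, ht, ENNReal.top_mul]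
  · exact (ENNReal.continuous_const_mul hc).lowerSemicontinuous

theorem LowerSemicontinuous.const_mul_ennreal {X : Type*} [TopologicalSpace X] {f : X → ℝ≥0∞}
    (hf : LowerSemicontinuous f) (c : ℝ≥0∞) : LowerSemicontinuous fun x => c * f x := by
  intro x t ht
  have hmono : Monotone fun z : ℝ≥0∞ => c * z := fun a b h => mul_le_mul_right h c
  rcases eq_or_ne (f x) 0 with h0 | h0
  · simp [h0] at ht
  obtain ⟨s, hs, hs2⟩ : ∃ s < f x, t < c * s := by
    have := (lowerSemicontinuous_const_mul_ennreal c) (f x) t ht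
    have := (this.filter_mono (nhdsWithin_le_nhds (s := Set.Iio (f x)))).and self_mem_nhdsWithin
    have hne : (nhdsWithin (f x) (Set.Iio (f x))).NeBot :=
      nhdsLT_neBot_of_exists_lt ⟨0, pos_iff_ne_zero.2 h0⟩
    obtain ⟨s, h1, h2⟩ := this.exists
    exact ⟨s, h2, h1⟩
  filter_upwards [hf x s hs] with z hz
  exact hs2.trans_le (hmono hz.le)

/-- The transform is a supremum of nonnegative multiples of positive parts of affine functions that
equal `-1` at the origin. -/
theorem gaugeTransform_mem_Cvx₀ {n : ℕ} (φ : EuclideanSpace ℝ (Fin n) → ℝ≥0∞) (α : ℝ) :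
    gaugeTransform α φ ∈ Cvx₀ n := by
  have hconv : ∀ x : EuclideanSpace ℝ (Fin n), ConvexOn ℝ≥0 Set.univ
      fun y : EuclideanSpace ℝ (Fin n) => ENNReal.ofReal (inner ℝ x y - 1) / legendre φ x := by
    intro x
    simp only [div_eq_mul_inv, mul_comm _ (legendre φ x)⁻¹]
    refine convexOn_mul_left_ennreal (convexOn_ofReal ?_) _
    exact ((innerSL ℝ x).toLinearMap.convexOn convex_univ).sub (concaveOn_const _ convex_univ)
  refine ⟨convexOn_mul_left_ennreal (convexOn_iSup_ennreal hconv) _,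
    LowerSemicontinuous.const_mul_ennreal (lowerSemicontinuous_iSup fun x => ?_) _, ?_⟩
  · simp only [div_eq_mul_inv, mul_comm _ (legendre φ x)⁻¹]
    have hcont : Continuous fun y : EuclideanSpace ℝ (Fin n) =>
        ENNReal.ofReal (inner ℝ x y - 1) := ENNReal.continuous_ofReal.comp (by fun_prop)
    exact LowerSemicontinuous.const_mul_ennreal hcont.lowerSemicontinuous _
  · simp [gaugeTransform, polarityScaled, polarity]

/-! ### Integrals through volumes of sublevel sets -/

theorem Cvx₀.measurable {n : ℕ} {φ : EuclideanSpace ℝ (Fin n) → ℝ≥0∞} (hφ : φ ∈ Cvx₀ n) :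
    Measurable φ := hφ.2.1.measurable

/-- This is `e^{-a} = ∫_a^∞ e^{-t} dt`, written with an indicator so that Tonelli yields the
layer-cake formula for `∫ e^{-φ}`. -/
theorem exp_neg_eq_lintegral (a : ℝ≥0∞) :
    EReal.exp (-(a : EReal)) = ∫⁻ t in Set.Ioi (0 : ℝ),
      ENNReal.ofReal (Real.exp (-t)) * Set.indicator {b | b ≤ ENNReal.ofReal t} 1 a := by
  rcases eq_or_ne a ⊤ with rfl | ha
  · simp
  · obtain ⟨b, hb, rfl⟩ : ∃ b : ℝ, 0 ≤ b ∧ a = ENNReal.ofReal b :=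
      ⟨a.toReal, ENNReal.toReal_nonneg, (ENNReal.ofReal_toReal ha).symm⟩
    have e : ∀ t ∈ Set.Ioi (0 : ℝ), ENNReal.ofReal (Real.exp (-t)) *
        Set.indicator {c | c ≤ ENNReal.ofReal t} 1 (ENNReal.ofReal b) =
        Set.indicator (Set.Ici b) (fun t => ENNReal.ofReal (Real.exp (-t))) t := by
      intro t ht
      by_cases h : b ≤ t
      · simp [Set.indicator, h, ENNReal.ofReal_le_ofReal h]
      · have : ¬ ENNReal.ofReal b ≤ ENNReal.ofReal t := by
          rw [ENNReal.ofReal_le_ofReal_iff (le_of_lt ht)]; exact h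
        simp [Set.indicator, h, this]
    rw [MeasureTheory.setLIntegral_congr_fun measurableSet_Ioi e,
      MeasureTheory.lintegral_indicator measurableSet_Ici,
      MeasureTheory.Measure.restrict_restrict measurableSet_Ici]
    have hae : MeasureTheory.volume.restrict (Set.Ici b ∩ Set.Ioi 0) =
        MeasureTheory.volume.restrict (Set.Ioi b) := by
      rcases hb.eq_or_lt with rfl | hb
      · rw [Set.inter_eq_right.2 Set.Ioi_subset_Ici_self]
      · have : Set.Ici b ∩ Set.Ioi 0 = Set.Ici b :=
          Set.inter_eq_left.2 fun x hx => Set.mem_Ioi.2 (lt_of_lt_of_le hb (Set.mem_Ici.1 hx))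
        rw [this]
        exact MeasureTheory.restrict_Ioi_eq_restrict_Ici.symm
    rw [hae, ← MeasureTheory.ofReal_integral_eq_lintegral_ofReal
      (integrableOn_exp_neg_Ioi b) (Filter.Eventually.of_forall fun t => (Real.exp_pos _).le),
      integral_exp_neg_Ioi, EReal.coe_ennreal_ofReal, max_eq_left hb, ← EReal.coe_neg,
      EReal.exp_coe]

theorem integralExpNeg_eq_lintegral_volume {n : ℕ} {φ : EuclideanSpace ℝ (Fin n) → ℝ≥0∞}
    (hφ : Measurable φ) :
    integralExpNeg φ = ∫⁻ t in Set.Ioi (0 : ℝ), ENNReal.ofReal (Real.exp (-t)) *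
      MeasureTheory.volume {x | φ x ≤ ENNReal.ofReal t} := by
  unfold integralExpNeg
  simp only [exp_neg_eq_lintegral]
  have hset : MeasurableSet
      {p : EuclideanSpace ℝ (Fin n) × ℝ | φ p.1 ≤ ENNReal.ofReal p.2} :=
    measurableSet_le (hφ.comp measurable_fst) (ENNReal.measurable_ofReal.comp measurable_snd)
  rw [MeasureTheory.lintegral_lintegral_swap]
  · refine MeasureTheory.lintegral_congr fun t => ?_
    rw [MeasureTheory.lintegral_const_mul' _ _ ENNReal.ofReal_ne_top]
    congr 1
    have : MeasurableSet {x | φ x ≤ ENNReal.ofReal t} := measurableSet_le hφ measurable_const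
    rw [← MeasureTheory.lintegral_indicator_one this]
    rfl
  · refine Measurable.aemeasurable ?_
    refine Measurable.mul (by fun_prop) ?_
    exact (measurable_const (a := (1 : ℝ≥0∞))).indicator hset

theorem volume_gaugeTransform_le {n : ℕ} {φ : EuclideanSpace ℝ (Fin n) → ℝ≥0∞}
    (hφ : φ ∈ Cvx₀ n) {α u : ℝ} (hα : 0 < α) (hu : 0 < u) :
    MeasureTheory.volume {x | gaugeTransform α φ x ≤ ENNReal.ofReal u} =
      ENNReal.ofReal ((u / α) ^ n) * MeasureTheory.volume {x | φ x ≤ ENNReal.ofReal (α / u)} := by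
  have : {x | gaugeTransform α φ x ≤ ENNReal.ofReal u} =
      (fun x => (α / u) • x) ⁻¹' {x | φ x ≤ ENNReal.ofReal (α / u)} := by
    ext x; exact gaugeTransform_le_iff hφ hα hu x
  rw [this, MeasureTheory.Measure.addHaar_preimage_smul _ (by positivity), finrank_euclideanSpace,
    Fintype.card_fin, ← inv_pow, inv_div, abs_of_nonneg (by positivity)]

/-- The weight `α t^{-n-2} e^{-α/t}` on `(0, ∞)`. -/
def nuWeight (α : ℝ) (n : ℕ) (t : ℝ) : ℝ := α / t ^ (n + 2) * Real.exp (-(α / t))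

theorem lintegral_Ioi_comp_const_div {α : ℝ} (hα : 0 < α) (f : ℝ → ℝ≥0∞) :
    ∫⁻ u in Set.Ioi (0 : ℝ), f u =
      ∫⁻ t in Set.Ioi (0 : ℝ), ENNReal.ofReal (α / t ^ 2) * f (α / t) := by
  have him : (fun t : ℝ => α / t) '' Set.Ioi 0 = Set.Ioi 0 := by
    ext x
    constructor
    · rintro ⟨t, ht, rfl⟩
      exact div_pos hα ht
    · intro hx
      exact ⟨α / x, div_pos hα hx, by have := (Set.mem_Ioi.1 hx).ne'; field_simp⟩
  have := MeasureTheory.lintegral_image_eq_lintegral_abs_deriv_mul (s := Set.Ioi (0 : ℝ))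
    (f := fun t => α / t) (f' := fun t => -(α / t ^ 2)) measurableSet_Ioi
    (fun t ht => by
      have := ((hasDerivAt_inv (Set.mem_Ioi.1 ht).ne').const_mul α).hasDerivWithinAt (s := Set.Ioi 0)
      simpa [div_eq_mul_inv] using this)
    (fun x hx y hy h => by
      have hx := (Set.mem_Ioi.1 hx).ne'
      have hy := (Set.mem_Ioi.1 hy).ne'
      simp only at h
      field_simp at h
      exact h.symm) f
  rw [him] at this
  rw [this]
  refine MeasureTheory.setLIntegral_congr_fun measurableSet_Ioi fun t ht => ?_
  have : 0 ≤ α / t ^ 2 := by positivity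
  simp only [abs_neg, abs_of_nonneg this]

/-- Under `u = α/t` the dilation contributes `t^{-n}` and the Jacobian `α/t²`; with `e^{-α/t}` these
make up the weight. -/
theorem integralExpNeg_gaugeTransform {n : ℕ} {φ : EuclideanSpace ℝ (Fin n) → ℝ≥0∞}
    (hφ : φ ∈ Cvx₀ n) {α : ℝ} (hα : 0 < α) :
    integralExpNeg (gaugeTransform α φ) = ∫⁻ t in Set.Ioi (0 : ℝ),
      ENNReal.ofReal (nuWeight α n t) * MeasureTheory.volume {x | φ x ≤ ENNReal.ofReal t} := by
  rw [integralExpNeg_eq_lintegral_volume (Cvx₀.measurable (gaugeTransform_mem_Cvx₀ φ α)),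
    lintegral_Ioi_comp_const_div hα]
  refine MeasureTheory.setLIntegral_congr_fun measurableSet_Ioi fun t ht => ?_
  have ht : 0 < t := ht
  have e1 : α / (α / t) = t := by field_simp
  have e2 : α / t / α = 1 / t := by field_simp
  rw [volume_gaugeTransform_le hφ hα (by positivity), e1, e2, ← mul_assoc, ← mul_assoc,
    ← ENNReal.ofReal_mul (by positivity), ← ENNReal.ofReal_mul (by positivity)]
  congr 2
  rw [nuWeight, div_pow, one_pow, pow_add]
  field_simp

/-- The level `t` goes to `α/t` and back, and the two dilations `t/α` and `1/t` compose to `1/α`. So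
`𝒥` is an involution up to scaling, which later exchanges maximizers and minimizers. -/
theorem integralExpNeg_gaugeTransform_gaugeTransform {n : ℕ}
    {φ : EuclideanSpace ℝ (Fin n) → ℝ≥0∞} (hφ : φ ∈ Cvx₀ n) {α : ℝ} (hα : 0 < α) :
    integralExpNeg (gaugeTransform α (gaugeTransform α φ)) =
      ENNReal.ofReal ((α ^ n)⁻¹) * integralExpNeg φ := by
  have hJ := gaugeTransform_mem_Cvx₀ φ α
  rw [integralExpNeg_eq_lintegral_volume (Cvx₀.measurable (gaugeTransform_mem_Cvx₀ _ α)),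
    integralExpNeg_eq_lintegral_volume (Cvx₀.measurable hφ),
    ← MeasureTheory.lintegral_const_mul' _ _ ENNReal.ofReal_ne_top]
  refine MeasureTheory.setLIntegral_congr_fun measurableSet_Ioi fun t ht => ?_
  have ht : 0 < t := ht
  have e1 : α / (α / t) = t := by field_simp
  have e2 : (t / α) ^ n * (α / t / α) ^ n = (α ^ n)⁻¹ := by
    rw [← mul_pow, ← inv_pow]
    congr 1
    field_simp
  rw [volume_gaugeTransform_le hJ hα ht, volume_gaugeTransform_le hφ hα (by positivity), e1,
    ← mul_assoc (ENNReal.ofReal ((t / α) ^ n)), ← ENNReal.ofReal_mul (by positivity), e2,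
    mul_left_comm]

/-! ### The functions `ψ` -/

/-- The radius of the sublevel sets of `psi K r t₀` with respect to `K`. -/
def levelRadius (r t₀ t : ℝ) : ℝ := min t (r * t + (1 - r) * t₀)

theorem levelRadius_pos {r t₀ t : ℝ} (hr : r ∈ Set.Icc (0 : ℝ) 1) (ht₀ : 0 < t₀) (ht : 0 < t) :
    0 < levelRadius r t₀ t := by
  refine lt_min ht ?_
  rcases hr.1.eq_or_lt with rfl | h
  · simpa using ht₀
  · have := mul_pos h ht
    have := mul_nonneg (sub_nonneg.2 hr.2) ht₀.le
    linarith

section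
variable {n : ℕ} {K : ConvexBody (EuclideanSpace ℝ (Fin n))}
  (hK : (0 : EuclideanSpace ℝ (Fin n)) ∈ interior (K : Set (EuclideanSpace ℝ (Fin n))))
include hK

theorem mem_smul_iff_gauge_le {s : ℝ} (hs : 0 < s) (x : EuclideanSpace ℝ (Fin n)) :
    x ∈ s • (K : Set (EuclideanSpace ℝ (Fin n))) ↔
      gauge (K : Set (EuclideanSpace ℝ (Fin n))) x ≤ s := by
  rw [Set.mem_smul_set_iff_inv_smul_mem₀ hs.ne']
  conv_lhs => rw [← K.isClosed.closure_eq]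
  rw [← gauge_le_one_iff_mem_closure K.convex (mem_interior_iff_mem_nhds.1 hK),
    gauge_smul_of_nonneg (inv_nonneg.2 hs.le), smul_eq_mul, inv_mul_le_iff₀ hs, mul_one]

/-- A maximum of increasing functions of the gauge is inverted by the minimum of their inverses. For
`r = 0` the second inverse is the constant `t₀`, so `levelRadius` needs no case distinction. -/
theorem psi_le_iff {r t₀ t : ℝ} (hr : r ∈ Set.Icc (0 : ℝ) 1) (ht₀ : 0 < t₀) (ht : 0 < t)
    (x : EuclideanSpace ℝ (Fin n)) :
    psi K r t₀ x ≤ ENNReal.ofReal t ↔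
      gauge (K : Set (EuclideanSpace ℝ (Fin n))) x ≤ levelRadius r t₀ t := by
  unfold psi levelRadius
  split_ifs with h
  · subst h
    rw [max_le_iff, ENNReal.ofReal_le_ofReal_iff ht.le, le_min_iff]
    simp only [convexIndicator, mem_smul_iff_gauge_le hK ht₀]
    split_ifs with h2 <;> simp [h2]
  · have hr0 : 0 < r := lt_of_le_of_ne hr.1 (Ne.symm h)
    rw [ENNReal.ofReal_le_ofReal_iff ht.le, max_le_iff, le_min_iff]
    refine and_congr_right fun _ => ?_
    rw [one_div, div_mul_eq_mul_div, inv_mul_eq_div, ← sub_div, div_le_iff₀ hr0]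
    constructor <;> intro h <;> linarith

theorem volume_psi_le {r t₀ t : ℝ} (hr : r ∈ Set.Icc (0 : ℝ) 1) (ht₀ : 0 < t₀) (ht : 0 < t) :
    MeasureTheory.volume {x | psi K r t₀ x ≤ ENNReal.ofReal t} =
      ENNReal.ofReal (levelRadius r t₀ t ^ n) *
        MeasureTheory.volume (K : Set (EuclideanSpace ℝ (Fin n))) := by
  have h0 := levelRadius_pos hr ht₀ ht
  have : {x | psi K r t₀ x ≤ ENNReal.ofReal t} =
      levelRadius r t₀ t • (K : Set (EuclideanSpace ℝ (Fin n))) := by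
    ext x
    rw [mem_smul_iff_gauge_le hK h0]
    exact psi_le_iff hK hr ht₀ ht x
  rw [this, MeasureTheory.Measure.addHaar_smul, finrank_euclideanSpace, Fintype.card_fin,
    abs_of_nonneg (by positivity)]

theorem convexOn_gauge_body : ConvexOn ℝ Set.univ
    (gauge (K : Set (EuclideanSpace ℝ (Fin n)))) := by
  have habs : Absorbent ℝ (K : Set (EuclideanSpace ℝ (Fin n))) :=
    absorbent_nhds_zero (mem_interior_iff_mem_nhds.1 hK)
  refine ⟨convex_univ, fun x _ y _ a b ha hb _ => ?_⟩
  refine (gauge_add_le K.convex habs _ _).trans ?_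
  rw [gauge_smul_of_nonneg ha, gauge_smul_of_nonneg hb]

theorem psi_mem_Cvx₀ {r t₀ : ℝ} (hr : r ∈ Set.Icc (0 : ℝ) 1) (ht₀ : 0 < t₀) :
    psi K r t₀ ∈ Cvx₀ n := by
  have hg := convexOn_gauge_body hK
  have hcont : Continuous (gauge (K : Set (EuclideanSpace ℝ (Fin n)))) :=
    continuous_gauge K.convex (mem_interior_iff_mem_nhds.1 hK)
  have hK0 : (0 : EuclideanSpace ℝ (Fin n)) ∈ (K : Set (EuclideanSpace ℝ (Fin n))) :=
    interior_subset hK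
  refine ⟨?_, ?_, ?_⟩
  · unfold psi
    split_ifs with h
    · have h1 := convexOn_ofReal hg
      refine ⟨convex_univ, fun x hx y hy a b ha hb hab => max_le ?_ ?_⟩
      · refine (h1.2 hx hy ha hb hab).trans ?_
        simp only [ENNReal.smul_def, smul_eq_mul]
        gcongr <;> exact le_max_left _ _
      -- Zero weights are treated apart because `0 * ∞ = 0`; with both weights nonzero, a point off
      -- `t₀ K` makes the right side infinite.
      · by_cases ha0 : a = 0
        · have hb1 : b = 1 := by simpa [ha0] using hab
          simp [ha0, hb1]
        by_cases hb0 : b = 0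
        · have ha1 : a = 1 := by simpa [hb0] using hab
          simp [ha1, hb0]
        have hac : (a : ℝ≥0∞) ≠ 0 := by simpa using ha0
        have hbc : (b : ℝ≥0∞) ≠ 0 := by simpa using hb0
        by_cases hx2 : x ∈ t₀ • (K : Set (EuclideanSpace ℝ (Fin n)))
        · by_cases hy2 : y ∈ t₀ • (K : Set (EuclideanSpace ℝ (Fin n)))
          · have : a • x + b • y ∈ t₀ • (K : Set (EuclideanSpace ℝ (Fin n))) :=
              (K.convex.smul t₀) hx2 hy2 a.2 b.2 (congrArg NNReal.toReal hab)
            simp [convexIndicator, this]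
          · simp [convexIndicator, hy2, ENNReal.smul_def, ENNReal.mul_top hbc]
        · simp [convexIndicator, hx2, ENNReal.smul_def, ENNReal.mul_top hac]
    · have hr0 : 0 < r := lt_of_le_of_ne hr.1 (Ne.symm h)
      refine convexOn_ofReal (hg.sup ?_)
      refine ConvexOn.sub ?_ (concaveOn_const _ convex_univ)
      exact hg.smul (by positivity : (0 : ℝ) ≤ 1 / r)
  · unfold psi
    split_ifs with h
    · refine LowerSemicontinuous.sup (ENNReal.continuous_ofReal.comp hcont).lowerSemicontinuous ?_
      rw [lowerSemicontinuous_iff_isClosed_preimage]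
      intro t
      have hcl : IsClosed (t₀ • (K : Set (EuclideanSpace ℝ (Fin n)))) :=
        K.isClosed.smul_of_ne_zero ht₀.ne'
      rcases eq_or_ne t ⊤ with rfl | ht
      · simp
      · convert! hcl using 1
        ext x
        by_cases hx : x ∈ t₀ • (K : Set (EuclideanSpace ℝ (Fin n))) <;>
          simp [convexIndicator, hx, ht]
    · exact (ENNReal.continuous_ofReal.comp (by fun_prop)).lowerSemicontinuous
  · have h0 : (0 : EuclideanSpace ℝ (Fin n)) ∈ t₀ • (K : Set (EuclideanSpace ℝ (Fin n))) :=
      ⟨0, hK0, smul_zero _⟩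
    unfold psi
    split_ifs with h
    · simp [convexIndicator, h0]
    · have : 0 ≤ (1 - r) / r * t₀ := by
        have := sub_nonneg.2 hr.2
        have := hr.1
        positivity
      simpa using this

end

/-! ### One-dimensional comparison of weighted integrals -/

theorem nuWeight_nonneg {α : ℝ} (hα : 0 < α) (n : ℕ) {t : ℝ} (ht : 0 < t) : 0 ≤ nuWeight α n t := by
  unfold nuWeight; positivity

theorem measurable_nuWeight (α : ℝ) (n : ℕ) : Measurable (nuWeight α n) := by
  unfold nuWeight; fun_prop

theorem lintegral_exp_neg_mul_pow (n : ℕ) :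
    ∫⁻ t in Set.Ioi (0 : ℝ), ENNReal.ofReal (Real.exp (-t)) * ENNReal.ofReal (t ^ n) =
      ENNReal.ofReal n.factorial := by
  have h := Real.GammaIntegral_convergent (s := n + 1) (by positivity)
  rw [← Real.Gamma_nat_eq_factorial, Real.Gamma_eq_integral (by positivity),
    MeasureTheory.ofReal_integral_eq_lintegral_ofReal h]
  · refine MeasureTheory.setLIntegral_congr_fun measurableSet_Ioi fun t ht => ?_
    rw [← ENNReal.ofReal_mul (by positivity)]
    simp
  · refine (MeasureTheory.ae_restrict_iff' measurableSet_Ioi).2 (Filter.Eventually.of_forall ?_)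
    intro t ht
    have := Set.mem_Ioi.1 ht
    simp only [Pi.zero_apply]
    positivity

/-- Here `ν(t) t^n = (α/t²) e^{-α/t}` is the pullback of `e^{-u}` under `u = α/t`. Together with `∫
e^{-t} t^n = n!`, linear profiles have ratio `1/n!`. -/
theorem lintegral_nuWeight_mul_pow {α : ℝ} (hα : 0 < α) (n : ℕ) :
    ∫⁻ t in Set.Ioi (0 : ℝ), ENNReal.ofReal (nuWeight α n t) * ENNReal.ofReal (t ^ n) = 1 := by
  have h := lintegral_exp_neg_mul_pow 0
  rw [lintegral_Ioi_comp_const_div hα] at h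
  simp only [pow_zero, ENNReal.ofReal_one, mul_one, Nat.factorial_zero, Nat.cast_one] at h
  rw [← h]
  refine MeasureTheory.setLIntegral_congr_fun measurableSet_Ioi fun t ht => ?_
  have ht : 0 < t := ht
  rw [← ENNReal.ofReal_mul (nuWeight_nonneg hα n ht), ← ENNReal.ofReal_mul (by positivity)]
  congr 1
  rw [nuWeight, pow_add]
  field_simp

/-- If `h` is larger than `g` where `k ≥ M m` and smaller where `k ≤ M m`, then the inequality
`∫ k hⁿ ≤ M ∫ m hⁿ` passes to `g`. -/
theorem lintegral_pow_le_of_comparison {k m g h : ℝ → ℝ} {M : ℝ} (n : ℕ) (hM : 0 ≤ M)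
    (hk : Measurable k) (hm : Measurable m) (hh : Measurable h)
    (hk0 : ∀ t, 0 < t → 0 ≤ k t) (hm0 : ∀ t, 0 < t → 0 ≤ m t)
    (hg0 : ∀ t, 0 < t → 0 ≤ g t) (hh0 : ∀ t, 0 < t → 0 ≤ h t)
    (hcomp : ∀ t, 0 < t → (k t ≤ M * m t ∧ h t ≤ g t) ∨ (M * m t ≤ k t ∧ g t ≤ h t))
    (hfin : ∫⁻ t in Set.Ioi (0 : ℝ), ENNReal.ofReal (m t) * ENNReal.ofReal (h t ^ n) ≠ ⊤)
    (hle : ∫⁻ t in Set.Ioi (0 : ℝ), ENNReal.ofReal (k t) * ENNReal.ofReal (h t ^ n) ≤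
      ENNReal.ofReal M * ∫⁻ t in Set.Ioi (0 : ℝ), ENNReal.ofReal (m t) * ENNReal.ofReal (h t ^ n)) :
    ∫⁻ t in Set.Ioi (0 : ℝ), ENNReal.ofReal (k t) * ENNReal.ofReal (g t ^ n) ≤
      ENNReal.ofReal M *
        ∫⁻ t in Set.Ioi (0 : ℝ), ENNReal.ofReal (m t) * ENNReal.ofReal (g t ^ n) := by
  -- This is `(k - M m)(g^n - h^n) ≤ 0` without subtraction, since the integrals of `g^n` may be
  -- infinite. Only the `h`-terms have to be measurable to split the integrals.
  have hpt : ∀ t ∈ Set.Ioi (0 : ℝ),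
      ENNReal.ofReal (k t) * ENNReal.ofReal (g t ^ n) +
        ENNReal.ofReal M * (ENNReal.ofReal (m t) * ENNReal.ofReal (h t ^ n)) ≤
      ENNReal.ofReal M * (ENNReal.ofReal (m t) * ENNReal.ofReal (g t ^ n)) +
        ENNReal.ofReal (k t) * ENNReal.ofReal (h t ^ n) := by
    intro t ht
    have h1 := hk0 t ht
    have h2 := hm0 t ht
    have h3 := hg0 t ht
    have h4 := hh0 t ht
    rw [← ENNReal.ofReal_mul h1, ← ENNReal.ofReal_mul h2, ← ENNReal.ofReal_mul hM,
      ← ENNReal.ofReal_add (by positivity) (by positivity), ← ENNReal.ofReal_mul h2,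
      ← ENNReal.ofReal_mul hM, ← ENNReal.ofReal_mul h1,
      ← ENNReal.ofReal_add (by positivity) (by positivity)]
    refine ENNReal.ofReal_le_ofReal ?_
    rcases hcomp t ht with ⟨h5, h6⟩ | ⟨h5, h6⟩
    · have := pow_le_pow_left₀ h4 h6 n
      nlinarith [mul_nonneg (sub_nonneg.2 h5) (sub_nonneg.2 this)]
    · have := pow_le_pow_left₀ h3 h6 n
      nlinarith [mul_nonneg (sub_nonneg.2 h5) (sub_nonneg.2 this)]
  have hmeas1 : Measurable fun t => ENNReal.ofReal M *
      (ENNReal.ofReal (m t) * ENNReal.ofReal (h t ^ n)) := by fun_prop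
  have hmeas2 : Measurable fun t => ENNReal.ofReal (k t) * ENNReal.ofReal (h t ^ n) := by fun_prop
  have hint := MeasureTheory.setLIntegral_mono' (μ := MeasureTheory.volume) measurableSet_Ioi hpt
  rw [MeasureTheory.lintegral_add_right _ hmeas1, MeasureTheory.lintegral_add_right _ hmeas2,
    MeasureTheory.lintegral_const_mul' _ _ ENNReal.ofReal_ne_top,
    MeasureTheory.lintegral_const_mul' _ _ ENNReal.ofReal_ne_top] at hint
  have hfin2 := ENNReal.mul_ne_top (ENNReal.ofReal_ne_top (r := M)) hfin
  exact (ENNReal.add_le_add_iff_right hfin2).1 (hint.trans (by gcongr))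

/-- `∫ ν gⁿ ≤ M ∫ e^{-t} gⁿ` on `(0, ∞)`. -/
def RatioLE (α : ℝ) (n : ℕ) (M : ℝ) (g : ℝ → ℝ) : Prop :=
  ∫⁻ t in Set.Ioi (0 : ℝ), ENNReal.ofReal (nuWeight α n t) * ENNReal.ofReal (g t ^ n) ≤
    ENNReal.ofReal M *
      ∫⁻ t in Set.Ioi (0 : ℝ), ENNReal.ofReal (Real.exp (-t)) * ENNReal.ofReal (g t ^ n)

theorem lintegral_mul_const_mul_pow (k g : ℝ → ℝ) {p : ℝ} (hp : 0 ≤ p) (n : ℕ) :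
    ∫⁻ t in Set.Ioi (0 : ℝ), ENNReal.ofReal (k t) * ENNReal.ofReal ((p * g t) ^ n) =
      ENNReal.ofReal (p ^ n) *
        ∫⁻ t in Set.Ioi (0 : ℝ), ENNReal.ofReal (k t) * ENNReal.ofReal (g t ^ n) := by
  rw [← MeasureTheory.lintegral_const_mul' _ _ ENNReal.ofReal_ne_top]
  refine MeasureTheory.lintegral_congr fun t => ?_
  rw [mul_pow, ENNReal.ofReal_mul (by positivity), mul_left_comm]

theorem RatioLE.const_mul {α M p : ℝ} {n : ℕ} {g : ℝ → ℝ} (h : RatioLE α n M g) (hp : 0 ≤ p) :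
    RatioLE α n M fun t => p * g t := by
  unfold RatioLE at *
  rw [lintegral_mul_const_mul_pow _ _ hp, lintegral_mul_const_mul_pow _ _ hp, mul_left_comm]
  gcongr

theorem ratioLE_id {α M : ℝ} (hα : 0 < α) {n : ℕ} (hM : 1 ≤ M * n.factorial) :
    RatioLE α n M fun t => t := by
  unfold RatioLE
  rw [lintegral_exp_neg_mul_pow, lintegral_nuWeight_mul_pow hα,
    ← ENNReal.ofReal_mul' (by positivity)]
  simpa using hM

theorem RatioLE.of_comparison {α M p : ℝ} {n : ℕ} {g h : ℝ → ℝ} (hα : 0 < α) (hM : 0 ≤ M)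
    (hh : Measurable h) (hg0 : ∀ t, 0 < t → 0 ≤ g t) (hh0 : ∀ t, 0 < t → 0 ≤ h t)
    (hhp : ∀ t, 0 < t → h t ≤ p * t)
    (hcomp : ∀ t, 0 < t → (nuWeight α n t ≤ M * Real.exp (-t) ∧ h t ≤ g t) ∨
      (M * Real.exp (-t) ≤ nuWeight α n t ∧ g t ≤ h t))
    (hle : RatioLE α n M h) : RatioLE α n M g := by
  refine lintegral_pow_le_of_comparison n hM (measurable_nuWeight α n) (by fun_prop) hh
    (fun t ht => nuWeight_nonneg hα n ht) (fun t _ => (Real.exp_pos _).le) hg0 hh0 hcomp ?_ hle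
  have hp : 0 ≤ p := by
    have := (hh0 1 one_pos).trans (hhp 1 one_pos)
    linarith
  refine ne_top_of_le_ne_top ?_ (MeasureTheory.setLIntegral_mono' measurableSet_Ioi
    (g := fun t => ENNReal.ofReal (Real.exp (-t)) * ENNReal.ofReal ((p * t) ^ n)) fun t ht => ?_)
  · rw [lintegral_mul_const_mul_pow _ (fun t => t) hp, lintegral_exp_neg_mul_pow]
    exact ENNReal.mul_ne_top ENNReal.ofReal_ne_top ENNReal.ofReal_ne_top
  · have := pow_le_pow_left₀ (hh0 t ht) (hhp t ht) n
    gcongr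

/-- Concave functions are compared with linear ones when the weights cross once. -/
theorem ratioLE_of_single_crossing {α M c : ℝ} {n : ℕ} {g : ℝ → ℝ} (hα : 0 < α) (hc : 0 < c)
    (hM : 1 ≤ M * n.factorial)
    (hlow : ∀ t, 0 < t → t ≤ c → nuWeight α n t ≤ M * Real.exp (-t))
    (hhigh : ∀ t, c ≤ t → M * Real.exp (-t) ≤ nuWeight α n t)
    (hg : ∀ s t, 0 < s → s ≤ t → g t * s ≤ g s * t) (hg0 : ∀ t, 0 < t → 0 ≤ g t) :
    RatioLE α n M g := by
  have hM0 : 0 ≤ M := by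
    by_contra! h
    have : M * n.factorial ≤ 0 := mul_nonpos_of_nonpos_of_nonneg h.le (by positivity)
    linarith
  have hp : 0 ≤ g c / c := div_nonneg (hg0 c hc) hc.le
  -- The comparison function is the line through the origin and `(c, g c)`; `g(t)/t` is
  -- nonincreasing, so `g` lies above it before `c` and below it after.
  refine RatioLE.of_comparison (h := fun t => g c / c * t) (p := g c / c) hα hM0 (by fun_prop) hg0
    (fun t ht => by positivity) (fun t _ => le_rfl) (fun t ht => ?_) ((ratioLE_id hα hM).const_mul hp)
  rcases le_total t c with h | h
  · refine Or.inl ⟨hlow t ht h, ?_⟩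
    rw [div_mul_eq_mul_div, div_le_iff₀ hc]
    exact hg t c ht h
  · refine Or.inr ⟨hhigh t h, ?_⟩
    rw [div_mul_eq_mul_div, le_div_iff₀ hc]
    exact hg c t hc h

/-! ### Concave functions on the half-line -/

theorem ConcaveOn.three_point {S : Set ℝ} {g : ℝ → ℝ} (hg : ConcaveOn ℝ S g) {x y z : ℝ}
    (hx : x ∈ S) (hz : z ∈ S) (hxy : x ≤ y) (hyz : y ≤ z) :
    (z - y) * g x + (y - x) * g z ≤ (z - x) * g y := by
  rcases hxy.eq_or_lt with rfl | hxy
  · simp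
  have hxz : 0 < z - x := by linarith
  have h := hg.2 hx hz (div_nonneg (sub_nonneg.2 hyz) hxz.le)
    (div_nonneg (sub_nonneg.2 hxy.le) hxz.le) (by field_simp; ring)
  have e : ((z - y) / (z - x)) • x + ((y - x) / (z - x)) • z = y := by
    simp only [smul_eq_mul]; field_simp; ring
  rw [e] at h
  simp only [smul_eq_mul] at h
  calc (z - y) * g x + (y - x) * g z
      = (z - x) * ((z - y) / (z - x) * g x + (y - x) / (z - x) * g z) := by field_simp
    _ ≤ _ := by gcongr

/-- For concave `g` with `g(0) ≥ 0`, `g(t)/t` is nonincreasing. As `0` is outside the domain,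
concavity is used from a small `ε > 0`. -/
theorem concaveOn_Ioi_mul_le {g : ℝ → ℝ} (hg : ConcaveOn ℝ (Set.Ioi 0) g)
    (hg0 : ∀ t, 0 < t → 0 ≤ g t) {s t : ℝ} (hs : 0 < s) (hst : s ≤ t) : g t * s ≤ g s * t := by
  by_contra! h
  set D := g t * s - g s * t with hD
  have hD0 : 0 < D := by linarith
  set E := |g t - g s| + 1 with hE
  have hE0 : 0 < E := by positivity
  -- The three-point inequality gives `D ≤ ε (g t - g s)`, and this `ε` makes the right side at most
  -- `D/2`.
  set ε := min s (D / (2 * E)) with hε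
  have hε0 : 0 < ε := lt_min hs (by positivity)
  have h3 := ConcaveOn.three_point hg (Set.mem_Ioi.2 hε0) (Set.mem_Ioi.2 (hs.trans_le hst))
    (min_le_left s _) hst
  have h4 : 0 ≤ (t - s) * g ε := mul_nonneg (by linarith) (hg0 _ hε0)
  have h5 : ε * (g t - g s) ≤ D / 2 := by
    calc ε * (g t - g s) ≤ ε * E := by
          gcongr; rw [hE]; linarith [le_abs_self (g t - g s)]
      _ ≤ D / (2 * E) * E := by gcongr; exact min_le_right _ _
      _ = D / 2 := by field_simp
  nlinarith

theorem concaveOn_Ioi_mono {g : ℝ → ℝ} (hg : ConcaveOn ℝ (Set.Ioi 0) g)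
    (hg0 : ∀ t, 0 < t → 0 ≤ g t) {s t : ℝ} (hs : 0 < s) (hst : s ≤ t) : g s ≤ g t := by
  by_contra! h
  have ht := hs.trans_le hst
  -- The falling chord through `s` and `t` reaches zero at distance `d - 1` beyond `t`; one unit
  -- further `g` would be negative.
  set d := g t * (t - s) / (g s - g t) + 1 with hd
  have hgs : 0 < g s - g t := by linarith
  have hd0 : 0 < d := by
    have := hg0 t ht
    have : 0 ≤ g t * (t - s) / (g s - g t) :=
      div_nonneg (mul_nonneg this (by linarith)) hgs.le
    linarith
  have h3 := ConcaveOn.three_point hg (Set.mem_Ioi.2 hs) (Set.mem_Ioi.2 (by linarith : 0 < t + d))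
    hst (by linarith)
  have h4 : 0 ≤ (t - s) * g (t + d) := mul_nonneg (by linarith) (hg0 _ (by linarith))
  have h5 : d * (g s - g t) = g t * (t - s) + (g s - g t) := by
    rw [hd]; field_simp
  nlinarith

theorem RatioLE.congr {α M : ℝ} {n : ℕ} {g h : ℝ → ℝ} (hg : RatioLE α n M g)
    (e : ∀ t, 0 < t → h t = g t) : RatioLE α n M h := by
  have key : ∀ k : ℝ → ℝ,
      ∫⁻ t in Set.Ioi (0 : ℝ), ENNReal.ofReal (k t) * ENNReal.ofReal (h t ^ n) =
        ∫⁻ t in Set.Ioi (0 : ℝ), ENNReal.ofReal (k t) * ENNReal.ofReal (g t ^ n) := fun k =>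
    MeasureTheory.setLIntegral_congr_fun measurableSet_Ioi fun t ht => by simp only [e t ht]
  unfold RatioLE at *
  rw [key, key]
  exact hg

/-- If the weights cross three times, concave functions are compared with a minimum of a linear and
an affine function. -/
theorem ratioLE_of_triple_crossing {α M a b c : ℝ} {n : ℕ} {g : ℝ → ℝ} (hα : 0 < α)
    (ha : 0 < a) (hab : a ≤ b) (hbc : b < c) (hM : 1 ≤ M * n.factorial) (hM0 : 0 ≤ M)
    (h₁ : ∀ t, 0 < t → t ≤ a → nuWeight α n t ≤ M * Real.exp (-t))
    (h₂ : ∀ t, a ≤ t → t ≤ b → M * Real.exp (-t) ≤ nuWeight α n t)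
    (h₃ : ∀ t, b ≤ t → t ≤ c → nuWeight α n t ≤ M * Real.exp (-t))
    (h₄ : ∀ t, c ≤ t → M * Real.exp (-t) ≤ nuWeight α n t)
    (hext : ∀ r ∈ Set.Icc (0 : ℝ) 1, ∀ t₀ ∈ Set.Icc a c, RatioLE α n M (levelRadius r t₀))
    (hg : ConcaveOn ℝ (Set.Ioi 0) g) (hg0 : ∀ t, 0 < t → 0 ≤ g t) :
    RatioLE α n M g := by
  have hb : 0 < b := ha.trans_le hab
  have hc : 0 < c := hb.trans hbc
  have hcb : 0 < c - b := by linarith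
  set p := g a / a with hp
  set m := (g c - g b) / (c - b) with hm
  set β := (g b * c - g c * b) / (c - b) with hβ
  have hpa : p * a = g a := by rw [hp]; field_simp
  have hp0 : 0 ≤ p := div_nonneg (hg0 a ha) ha.le
  have hm0 : 0 ≤ m := div_nonneg (sub_nonneg.2 (concaveOn_Ioi_mono hg hg0 hb hbc.le)) hcb.le
  have hβ0 : 0 ≤ β := div_nonneg (sub_nonneg.2 (concaveOn_Ioi_mul_le hg hg0 hb hbc.le)) hcb.le
  have hline : ∀ t, m * t + β = (g b * (c - t) + g c * (t - b)) / (c - b) := by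
    intro t; rw [hm, hβ]; field_simp; ring
  have hmb : m * b + β = g b := by rw [hline]; field_simp; ring
  have hmc : m * c + β = g c := by rw [hline]; field_simp; ring
  have hout : ∀ t, 0 < t → t ≤ b ∨ c ≤ t → g t ≤ m * t + β := by
    intro t ht h
    rw [hline, le_div_iff₀ hcb]
    rcases h with h | h
    · have := ConcaveOn.three_point hg (Set.mem_Ioi.2 ht) (Set.mem_Ioi.2 hc) h hbc.le
      linarith
    · have := ConcaveOn.three_point hg (Set.mem_Ioi.2 hb) (Set.mem_Ioi.2 (hc.trans_le h)) hbc.le h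
      linarith
  have hin : ∀ t, b ≤ t → t ≤ c → m * t + β ≤ g t := by
    intro t h h'
    rw [hline, div_le_iff₀ hcb]
    have := ConcaveOn.three_point hg (Set.mem_Ioi.2 hb) (Set.mem_Ioi.2 hc) h h'
    linarith
  have hlow : ∀ t, 0 < t → t ≤ a → p * t ≤ g t := by
    intro t ht h
    have := concaveOn_Ioi_mul_le hg hg0 ht h
    rw [hp, div_mul_eq_mul_div, div_le_iff₀ ha]
    linarith
  have hhigh : ∀ t, a ≤ t → g t ≤ p * t := by
    intro t h
    have := concaveOn_Ioi_mul_le hg hg0 ha h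
    rw [hp, div_mul_eq_mul_div, le_div_iff₀ ha]
    linarith
  have hmp : m ≤ p := by
    have h1 : m * b ≤ p * b := by linarith [hhigh b hab]
    exact le_of_mul_le_mul_right h1 hb
  refine RatioLE.of_comparison (h := fun t => min (p * t) (m * t + β)) (p := p) hα hM0
    (by fun_prop) hg0 (fun t ht => le_min (by positivity) (by positivity))
    (fun t _ => min_le_left _ _) (fun t ht => ?_) ?_
  · rcases le_total t a with h | h
    · exact Or.inl ⟨h₁ t ht h, (min_le_left _ _).trans (hlow t ht h)⟩
    rcases le_total t b with h' | h'
    · exact Or.inr ⟨h₂ t h h', le_min (hhigh t h) (hout t ht (Or.inl h'))⟩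
    rcases le_total t c with h'' | h''
    · exact Or.inl ⟨h₃ t h' h'', (min_le_right _ _).trans (hin t h' h'')⟩
    · exact Or.inr ⟨h₄ t h'', le_min (hhigh t h) (hout t ht (Or.inr h''))⟩
  · rcases hmp.eq_or_lt with hmp | hmp
    · refine ((ratioLE_id hα hM).const_mul hp0).congr fun t ht => ?_
      exact min_eq_left (by rw [hmp]; linarith)
    have hpm : 0 < p - m := by linarith
    have hp1 : 0 < p := by linarith
    -- The two lines meet at `β / (p - m)`. This lies in `[a, c]`: the secant is at least `g a = p
    -- a` at `a`, and takes the value `g c ≤ p c` at `c`.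
    refine ((hext (m / p) ⟨by positivity, (div_le_one hp1).2 hmp.le⟩ (β / (p - m))
      ⟨?_, ?_⟩).const_mul hp0).congr fun t ht => ?_
    · rw [le_div_iff₀ hpm]
      have := hout a ha (Or.inl hab)
      linarith
    · rw [div_le_iff₀ hpm]
      have := hhigh c (hab.trans hbc.le)
      linarith
    · rw [levelRadius, mul_min_of_nonneg _ _ hp0]
      congr 1
      field_simp

/-! ### The quotient of the weights -/

/-- The quotient of the weights `α t^{-n-2} e^{-α/t}` and `e^{-t}`. -/
def weightRatio (α : ℝ) (n : ℕ) (t : ℝ) : ℝ := nuWeight α n t * Real.exp t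

theorem nuWeight_le_iff {α M t : ℝ} {n : ℕ} :
    nuWeight α n t ≤ M * Real.exp (-t) ↔ weightRatio α n t ≤ M := by
  rw [weightRatio, Real.exp_neg, ← div_eq_mul_inv, le_div_iff₀ (Real.exp_pos t)]

theorem le_nuWeight_iff {α M t : ℝ} {n : ℕ} :
    M * Real.exp (-t) ≤ nuWeight α n t ↔ M ≤ weightRatio α n t := by
  rw [weightRatio, Real.exp_neg, ← div_eq_mul_inv, div_le_iff₀ (Real.exp_pos t)]

theorem weightRatio_pos {α t : ℝ} (n : ℕ) (hα : 0 < α) (ht : 0 < t) : 0 < weightRatio α n t := by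
  unfold weightRatio nuWeight; positivity

/-- This is the logarithmic derivative of `α t^{-n-2} e^{t - α/t}`. Its numerator factors as `(t -
t₁)(t - t₂)` for `t₁ + t₂ = n + 2`, `t₁ t₂ = α`, which gives the three monotone branches. -/
theorem hasDerivAt_weightRatio {α t : ℝ} (n : ℕ) (ht : 0 < t) :
    HasDerivAt (weightRatio α n)
      (weightRatio α n t * ((t ^ 2 - (n + 2) * t + α) / t ^ 2)) t := by
  have ht' := ht.ne'
  have h1 : HasDerivAt (fun t : ℝ => α / t ^ (n + 2))
      (-(α * ((n + 2) * t ^ (n + 1))) / (t ^ (n + 2)) ^ 2) t := by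
    have := ((hasDerivAt_pow (n + 2) t).inv (pow_ne_zero _ ht')).const_mul α
    convert! this using 1
    push_cast
    ring
  have h2 : HasDerivAt (fun t : ℝ => Real.exp (-(α / t))) (Real.exp (-(α / t)) * (α / t ^ 2)) t := by
    have := (((hasDerivAt_inv ht').const_mul α).neg).exp
    convert! this using 1
    simp [div_eq_mul_inv]
  have := (h1.mul h2).mul (Real.hasDerivAt_exp t)
  convert! this using 1
  unfold weightRatio nuWeight
  simp only [Pi.mul_apply]
  field_simp
  ring

theorem continuousOn_weightRatio (α : ℝ) (n : ℕ) : ContinuousOn (weightRatio α n) (Set.Ioi 0) :=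
  fun _ ht => (hasDerivAt_weightRatio n ht).continuousAt.continuousWithinAt

theorem exists_large_weightRatio_ge {α : ℝ} (hα : 0 < α) (n : ℕ) (B X : ℝ) :
    ∃ c, X ≤ c ∧ B ≤ weightRatio α n c := by
  have h := (Real.tendsto_exp_div_pow_atTop (n + 2)).const_mul_atTop
    (by positivity : 0 < α * Real.exp (-α))
  obtain ⟨c, ⟨h1, h2⟩, h3⟩ := ((h.eventually_ge_atTop B).and
    (Filter.eventually_ge_atTop X)).and (Filter.eventually_ge_atTop 1) |>.exists
  refine ⟨c, h2, h1.trans ?_⟩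
  have : Real.exp (-α) ≤ Real.exp (-(α / c)) := by
    have := div_le_self hα.le h3
    gcongr
  calc α * Real.exp (-α) * (Real.exp c / c ^ (n + 2))
      ≤ α * Real.exp (-(α / c)) * (Real.exp c / c ^ (n + 2)) := by gcongr
    _ = weightRatio α n c := by unfold weightRatio nuWeight; ring

theorem exists_small_weightRatio_le {α : ℝ} (hα : 0 < α) (n : ℕ) {B X : ℝ} (hB : 0 < B)
    (hX : 0 < X) : ∃ a, 0 < a ∧ a ≤ X ∧ weightRatio α n a ≤ B := by
  have h := (Real.tendsto_pow_mul_exp_neg_atTop_nhds_zero (n + 2)).const_mul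
    (α / α ^ (n + 2) * Real.exp X)
  rw [mul_zero] at h
  obtain ⟨s, ⟨h1, h2⟩, h3⟩ := ((h.eventually (ge_mem_nhds hB)).and
    (Filter.eventually_ge_atTop (α / X))).and (Filter.eventually_gt_atTop 0) |>.exists
  have h4 : α / s ≤ X := by
    rw [div_le_iff₀ hX] at h2
    rw [div_le_iff₀ h3]
    linarith
  refine ⟨α / s, by positivity, h4, le_trans ?_ h1⟩
  unfold weightRatio nuWeight
  have e1 : α / (α / s) = s := by field_simp
  have e2 : α / (α / s) ^ (n + 2) = α / α ^ (n + 2) * s ^ (n + 2) := by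
    rw [div_pow]; field_simp
  rw [e1, e2]
  calc α / α ^ (n + 2) * s ^ (n + 2) * Real.exp (-s) * Real.exp (α / s)
      ≤ α / α ^ (n + 2) * s ^ (n + 2) * Real.exp (-s) * Real.exp X := by gcongr
    _ = _ := by ring

section
variable {α t₁ t₂ : ℝ} {n : ℕ} (h1 : 0 < t₁) (h12 : t₁ ≤ t₂) (hsum : t₁ + t₂ = n + 2)
  (hprod : t₁ * t₂ = α)
include h1 h12 hsum hprod

theorem weightRatio_mono_left : MonotoneOn (weightRatio α n) (Set.Ioc 0 t₁) := by
  have hα : 0 < α := hprod ▸ mul_pos h1 (h1.trans_le h12)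
  refine monotoneOn_of_deriv_nonneg (convex_Ioc 0 t₁)
    ((continuousOn_weightRatio α n).mono fun t ht => ht.1)
    (fun t ht => ?_) fun t ht => ?_
  all_goals rw [interior_Ioc] at ht
  · exact (hasDerivAt_weightRatio n ht.1).differentiableAt.differentiableWithinAt
  · rw [(hasDerivAt_weightRatio n ht.1).deriv]
    refine mul_nonneg (weightRatio_pos n hα ht.1).le (div_nonneg ?_ (sq_nonneg t))
    nlinarith [mul_nonneg (sub_nonneg.2 ht.2.le) (sub_nonneg.2 (ht.2.le.trans h12))]

theorem weightRatio_anti : AntitoneOn (weightRatio α n) (Set.Icc t₁ t₂) := by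
  have hα : 0 < α := hprod ▸ mul_pos h1 (h1.trans_le h12)
  refine antitoneOn_of_deriv_nonpos (convex_Icc t₁ t₂)
    ((continuousOn_weightRatio α n).mono fun t ht => Set.mem_Ioi.2 (h1.trans_le ht.1))
    (fun t ht => ?_) fun t ht => ?_
  all_goals
    rw [interior_Icc] at ht
    have ht0 : 0 < t := h1.trans ht.1
  · exact (hasDerivAt_weightRatio n ht0).differentiableAt.differentiableWithinAt
  · rw [(hasDerivAt_weightRatio n ht0).deriv]
    refine mul_nonpos_of_nonneg_of_nonpos (weightRatio_pos n hα ht0).le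
      (div_nonpos_of_nonpos_of_nonneg ?_ (sq_nonneg t))
    nlinarith [mul_nonneg (sub_nonneg.2 ht.1.le) (sub_nonneg.2 ht.2.le)]

theorem weightRatio_mono_right : MonotoneOn (weightRatio α n) (Set.Ici t₂) := by
  have hα : 0 < α := hprod ▸ mul_pos h1 (h1.trans_le h12)
  refine monotoneOn_of_deriv_nonneg (convex_Ici t₂)
    ((continuousOn_weightRatio α n).mono fun t ht =>
      Set.mem_Ioi.2 ((h1.trans_le h12).trans_le ht))
    (fun t ht => ?_) fun t ht => ?_
  all_goals
    rw [interior_Ici] at ht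
    have ht2 : t₂ < t := ht
    have ht0 : 0 < t := (h1.trans_le h12).trans ht
  · exact (hasDerivAt_weightRatio n ht0).differentiableAt.differentiableWithinAt
  · rw [(hasDerivAt_weightRatio n ht0).deriv]
    refine mul_nonneg (weightRatio_pos n hα ht0).le (div_nonneg ?_ (sq_nonneg t))
    nlinarith [mul_nonneg (sub_nonneg.2 ht2.le) (sub_nonneg.2 (h12.trans ht2.le))]

/-- If `M` is above the local maximum of the quotient of the weights, linear functions are
optimal. -/
theorem ratioLE_of_weightRatio_le {M : ℝ} (hM : 1 ≤ M * n.factorial)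
    (hMw : weightRatio α n t₁ ≤ M) {g : ℝ → ℝ}
    (hg : ConcaveOn ℝ (Set.Ioi 0) g) (hg0 : ∀ t, 0 < t → 0 ≤ g t) : RatioLE α n M g := by
  have h2 := h1.trans_le h12
  have hα : 0 < α := hprod ▸ mul_pos h1 h2
  have hmono := weightRatio_mono_right h1 h12 hsum hprod
  have hleft : ∀ t, 0 < t → t ≤ t₂ → weightRatio α n t ≤ M := by
    intro t ht h
    refine le_trans ?_ hMw
    rcases le_total t t₁ with h' | h'
    · exact weightRatio_mono_left h1 h12 hsum hprod ⟨ht, h'⟩ ⟨h1, le_rfl⟩ h'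
    · exact weightRatio_anti h1 h12 hsum hprod ⟨le_rfl, h12⟩ ⟨h', h⟩ h'
  obtain ⟨d, hd, hdM⟩ := exists_large_weightRatio_ge hα n M t₂
  obtain ⟨c, hc, hcM⟩ := intermediate_value_Icc hd
    ((continuousOn_weightRatio α n).mono fun t ht => Set.mem_Ioi.2 (h2.trans_le ht.1))
    ⟨hleft t₂ h2 le_rfl, hdM⟩
  refine ratioLE_of_single_crossing hα (h2.trans_le hc.1) hM (fun t ht h => ?_) (fun t h => ?_)
    (fun s t => concaveOn_Ioi_mul_le hg hg0) hg0
  · rw [nuWeight_le_iff]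
    rcases le_total t t₂ with h' | h'
    · exact hleft t ht h'
    · exact (hmono h' hc.1 h).trans hcM.le
  · rw [le_nuWeight_iff]
    exact hcM.ge.trans (hmono hc.1 (hc.1.trans h) h)

/-- For `M` at or below the local minimum, the weights can be taken to cross once, on the branch
left of `t₁`, so linear functions are again optimal. -/
theorem ratioLE_of_le_weightRatio {M : ℝ} (hM : 1 ≤ M * n.factorial)
    (hMw : M ≤ weightRatio α n t₂) {g : ℝ → ℝ}
    (hg : ConcaveOn ℝ (Set.Ioi 0) g) (hg0 : ∀ t, 0 < t → 0 ≤ g t) : RatioLE α n M g := by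
  have h2 := h1.trans_le h12
  have hα : 0 < α := hprod ▸ mul_pos h1 h2
  have hM0 : 0 < M := by
    by_contra! h
    have : M * n.factorial ≤ 0 := mul_nonpos_of_nonpos_of_nonneg h (by positivity)
    linarith
  have hmono := weightRatio_mono_left h1 h12 hsum hprod
  have hright : ∀ t, t₁ ≤ t → M ≤ weightRatio α n t := by
    intro t ht
    refine hMw.trans ?_
    rcases le_total t t₂ with h' | h'
    · exact weightRatio_anti h1 h12 hsum hprod ⟨ht, h'⟩ ⟨h12, le_rfl⟩ h'
    · exact weightRatio_mono_right h1 h12 hsum hprod (Set.mem_Ici.2 le_rfl) h' h'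
  obtain ⟨d, hd0, hd, hdM⟩ := exists_small_weightRatio_le hα n hM0 h1
  obtain ⟨c, hc, hcM⟩ := intermediate_value_Icc hd
    ((continuousOn_weightRatio α n).mono fun t ht => Set.mem_Ioi.2 (hd0.trans_le ht.1))
    ⟨hdM, hright t₁ le_rfl⟩
  have hc0 := hd0.trans_le hc.1
  refine ratioLE_of_single_crossing hα hc0 hM (fun t ht h => ?_) (fun t h => ?_)
    (fun s t => concaveOn_Ioi_mul_le hg hg0) hg0
  · rw [nuWeight_le_iff]
    exact (hmono ⟨ht, h.trans hc.2⟩ ⟨hc0, hc.2⟩ h).trans hcM.le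
  · rw [le_nuWeight_iff]
    rcases le_total t t₁ with h' | h'
    · exact hcM.ge.trans (hmono ⟨hc0, hc.2⟩ ⟨hc0.trans_le h, h'⟩ h)
    · exact hright t h'

/-- Above the local maximum or below the local minimum of the weight quotient a single crossing
suffices. In between there are three crossings, and the conditions on `a₀` and `c₀` trap the outer
two, so the kinks needed range over a fixed interval. -/
theorem ratioLE_of_levelRadius {M a₀ c₀ : ℝ} (hM : 1 ≤ M * n.factorial)
    (ha₀ : 0 < a₀) (ha₁ : a₀ ≤ t₁) (hc₀ : t₂ ≤ c₀) (haM : weightRatio α n a₀ ≤ M)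
    (hcM : weightRatio α n t₁ ≤ weightRatio α n c₀)
    (hext : ∀ r ∈ Set.Icc (0 : ℝ) 1, ∀ t₀ ∈ Set.Icc a₀ c₀, RatioLE α n M (levelRadius r t₀))
    {g : ℝ → ℝ} (hg : ConcaveOn ℝ (Set.Ioi 0) g) (hg0 : ∀ t, 0 < t → 0 ≤ g t) :
    RatioLE α n M g := by
  rcases le_total (weightRatio α n t₁) M with hw1 | hw1
  · exact ratioLE_of_weightRatio_le h1 h12 hsum hprod hM hw1 hg hg0
  rcases le_or_gt M (weightRatio α n t₂) with hw2 | hw2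
  · exact ratioLE_of_le_weightRatio h1 h12 hsum hprod hM hw2 hg hg0
  have h2 := h1.trans_le h12
  have hα : 0 < α := hprod ▸ mul_pos h1 h2
  have hcont := continuousOn_weightRatio α n
  have hl := weightRatio_mono_left h1 h12 hsum hprod
  have hm := weightRatio_anti h1 h12 hsum hprod
  have hr := weightRatio_mono_right h1 h12 hsum hprod
  obtain ⟨a, ha, haM'⟩ := intermediate_value_Icc ha₁
    (hcont.mono fun t ht => Set.mem_Ioi.2 (ha₀.trans_le ht.1)) ⟨haM, hw1⟩
  obtain ⟨b, hb, hbM⟩ := intermediate_value_Icc' h12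
    (hcont.mono fun t ht => Set.mem_Ioi.2 (h1.trans_le ht.1)) ⟨hw2.le, hw1⟩
  obtain ⟨c, hc, hcM'⟩ := intermediate_value_Icc hc₀
    (hcont.mono fun t ht => Set.mem_Ioi.2 (h2.trans_le ht.1)) ⟨hw2.le, hw1.trans hcM⟩
  have ha0 : 0 < a := ha₀.trans_le ha.1
  have hbc : b < c := by
    refine (hb.2.trans hc.1).lt_of_ne ?_
    rintro rfl
    have : b = t₂ := le_antisymm hb.2 hc.1
    rw [this] at hbM
    linarith
  refine ratioLE_of_triple_crossing hα ha0 (ha.2.trans hb.1) hbc hM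
    ((weightRatio_pos n hα ha₀).le.trans haM) ?_ ?_ ?_ ?_
    (fun r hr' t₀ ht₀ => hext r hr' t₀ ⟨ha.1.trans ht₀.1, ht₀.2.trans hc.2⟩) hg hg0
  · intro t ht h
    rw [nuWeight_le_iff]
    exact (hl ⟨ht, h.trans ha.2⟩ ⟨ha0, ha.2⟩ h).trans haM'.le
  · intro t h h'
    rw [le_nuWeight_iff]
    rcases le_total t t₁ with h'' | h''
    · exact haM'.ge.trans (hl ⟨ha0, ha.2⟩ ⟨ha0.trans_le h, h''⟩ h)
    · exact hbM.ge.trans (hm ⟨h'', h'.trans hb.2⟩ hb h')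
  · intro t h h'
    rw [nuWeight_le_iff]
    rcases le_total t t₂ with h'' | h''
    · exact (hm hb ⟨hb.1.trans h, h''⟩ h).trans hbM.le
    · exact (hr h'' hc.1 h').trans hcM'.le
  · intro t h
    rw [le_nuWeight_iff]
    exact hcM'.ge.trans (hr hc.1 (hc.1.trans h) h)

end

/-! ### Reduction to rays -/

theorem lintegral_polar {n : ℕ} (hn : 0 < n) {f : EuclideanSpace ℝ (Fin n) → ℝ≥0∞}
    (hf : Measurable f) :
    ∫⁻ x, f x = ∫⁻ v : Metric.sphere (0 : EuclideanSpace ℝ (Fin n)) 1,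
      (∫⁻ s in Set.Ioi (0 : ℝ), ENNReal.ofReal (s ^ (n - 1)) * f (s • (v : EuclideanSpace ℝ (Fin n))))
      ∂(MeasureTheory.volume : MeasureTheory.Measure (EuclideanSpace ℝ (Fin n))).toSphere := by
  have : Nonempty (Fin n) := ⟨⟨0, hn⟩⟩
  set μ := (MeasureTheory.volume : MeasureTheory.Measure (EuclideanSpace ℝ (Fin n)))
  have hmp := μ.measurePreserving_homeomorphUnitSphereProd
  rw [finrank_euclideanSpace, Fintype.card_fin] at hmp
  have hsm : Measurable fun p : Metric.sphere (0 : EuclideanSpace ℝ (Fin n)) 1 × Set.Ioi (0 : ℝ) =>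
      f ((p.2 : ℝ) • (p.1 : EuclideanSpace ℝ (Fin n))) := hf.comp (by fun_prop)
  have h1 : ∫⁻ x, f x ∂μ = ∫⁻ x : ({(0)}ᶜ : Set (EuclideanSpace ℝ (Fin n))), f x ∂(μ.comap (↑)) := by
    rw [MeasureTheory.lintegral_subtype_comap (measurableSet_singleton _).compl f,
      MeasureTheory.restrict_compl_singleton]
  have h2 : ∫⁻ x : ({(0)}ᶜ : Set (EuclideanSpace ℝ (Fin n))), f x ∂(μ.comap (↑)) =
      ∫⁻ p, f ((p.2 : ℝ) • (p.1 : EuclideanSpace ℝ (Fin n)))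
        ∂(μ.toSphere.prod (MeasureTheory.Measure.volumeIoiPow (n - 1))) := by
    rw [← hmp.lintegral_comp hsm]
    refine MeasureTheory.lintegral_congr fun x => ?_
    congr 1
    have hx : ‖(x : EuclideanSpace ℝ (Fin n))‖ ≠ 0 := norm_ne_zero_iff.2 x.2
    simp [smul_smul, hx]
  rw [h1, h2, MeasureTheory.lintegral_prod _ hsm.aemeasurable]
  refine MeasureTheory.lintegral_congr fun v => ?_
  rw [MeasureTheory.Measure.volumeIoiPow, MeasureTheory.lintegral_withDensity_eq_lintegral_mul]
  · simp only [Pi.mul_apply]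
    exact MeasureTheory.lintegral_subtype_comap measurableSet_Ioi
      (fun s : ℝ => ENNReal.ofReal (s ^ (n - 1)) * f (s • (v : EuclideanSpace ℝ (Fin n))))
  · fun_prop
  · exact hf.comp (by fun_prop)

/-- The integral of `s^{n-1}` over the part of the ray through `v` on which `φ ≤ t`. -/
def radialVolume {n : ℕ} (φ : EuclideanSpace ℝ (Fin n) → ℝ≥0∞) (v : EuclideanSpace ℝ (Fin n))
    (t : ℝ) : ℝ≥0∞ :=
  ∫⁻ s in Set.Ioi (0 : ℝ), ENNReal.ofReal (s ^ (n - 1)) *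
    Set.indicator {x | φ x ≤ ENNReal.ofReal t} 1 (s • v)

/-- Polar coordinates and Tonelli reduce an inequality between weighted integrals of sublevel
volumes to one on each ray. -/
theorem lintegral_volume_le_eq_lintegral_sphere {n : ℕ} (hn : 0 < n)
    {φ : EuclideanSpace ℝ (Fin n) → ℝ≥0∞} (hφ : Measurable φ) {k : ℝ → ℝ} (hk : Measurable k) :
    ∫⁻ t in Set.Ioi (0 : ℝ), ENNReal.ofReal (k t) *
        MeasureTheory.volume {x | φ x ≤ ENNReal.ofReal t} =
      ∫⁻ v : Metric.sphere (0 : EuclideanSpace ℝ (Fin n)) 1,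
        (∫⁻ t in Set.Ioi (0 : ℝ), ENNReal.ofReal (k t) * radialVolume φ v t)
        ∂(MeasureTheory.volume : MeasureTheory.Measure (EuclideanSpace ℝ (Fin n))).toSphere := by
  have hset : MeasurableSet {p : EuclideanSpace ℝ (Fin n) × ℝ | φ p.1 ≤ ENNReal.ofReal p.2} :=
    measurableSet_le (hφ.comp measurable_fst) (ENNReal.measurable_ofReal.comp measurable_snd)
  have hW : Measurable fun p : ℝ × Metric.sphere (0 : EuclideanSpace ℝ (Fin n)) 1 =>
      radialVolume φ p.2 p.1 := by
    unfold radialVolume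
    refine Measurable.lintegral_prod_right' (f := fun q :
      (ℝ × Metric.sphere (0 : EuclideanSpace ℝ (Fin n)) 1) × ℝ =>
        ENNReal.ofReal (q.2 ^ (n - 1)) *
          Set.indicator {x | φ x ≤ ENNReal.ofReal q.1.1} 1 (q.2 • (q.1.2 : EuclideanSpace ℝ (Fin n))))
      ?_
    refine Measurable.mul (by fun_prop) ?_
    have hm : Measurable fun q : (ℝ × Metric.sphere (0 : EuclideanSpace ℝ (Fin n)) 1) × ℝ =>
        (q.2 • (q.1.2 : EuclideanSpace ℝ (Fin n)), q.1.1) := by fun_prop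
    exact ((measurable_const (a := (1 : ℝ≥0∞))).indicator hset).comp hm
  have hvol : ∀ t : ℝ, MeasureTheory.volume {x | φ x ≤ ENNReal.ofReal t} =
      ∫⁻ v : Metric.sphere (0 : EuclideanSpace ℝ (Fin n)) 1, radialVolume φ v t
        ∂(MeasureTheory.volume : MeasureTheory.Measure (EuclideanSpace ℝ (Fin n))).toSphere := by
    intro t
    have : MeasurableSet {x | φ x ≤ ENNReal.ofReal t} := measurableSet_le hφ measurable_const
    rw [← MeasureTheory.lintegral_indicator_one this,
      lintegral_polar hn (measurable_one.indicator this)]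
    rfl
  simp only [hvol, ← MeasureTheory.lintegral_const_mul' _ _ ENNReal.ofReal_ne_top]
  rw [MeasureTheory.lintegral_lintegral_swap]
  refine Measurable.aemeasurable ?_
  exact Measurable.mul (by fun_prop) hW

theorem lintegral_Ioc_pow {n : ℕ} (hn : 0 < n) {b : ℝ} (hb : 0 ≤ b) :
    ∫⁻ s in Set.Ioc 0 b, ENNReal.ofReal (s ^ (n - 1)) = ENNReal.ofReal (b ^ n / n) := by
  obtain ⟨m, rfl⟩ : ∃ m, n = m + 1 := ⟨n - 1, by omega⟩
  rw [← MeasureTheory.ofReal_integral_eq_lintegral_ofReal,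
    ← intervalIntegral.integral_of_le hb, integral_pow]
  · simp
  · exact (intervalIntegral.intervalIntegrable_pow _).1
  · refine (MeasureTheory.ae_restrict_iff' measurableSet_Ioc).2 (Filter.Eventually.of_forall ?_)
    intro t ht
    have := ht.1
    simp only [Pi.zero_apply]
    positivity

theorem convexOn_ray_le {n : ℕ} {φ : EuclideanSpace ℝ (Fin n) → ℝ≥0∞} (hφ : φ ∈ Cvx₀ n)
    (v : EuclideanSpace ℝ (Fin n)) {s s' t t' a b : ℝ} (ha : 0 ≤ a) (hb : 0 ≤ b) (hab : a + b = 1)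
    (ht : 0 ≤ t) (ht' : 0 ≤ t')
    (h : φ (s • v) ≤ ENNReal.ofReal t) (h' : φ (s' • v) ≤ ENNReal.ofReal t') :
    φ ((a * s + b * s') • v) ≤ ENNReal.ofReal (a * t + b * t') := by
  lift a to ℝ≥0 using ha
  lift b to ℝ≥0 using hb
  have := hφ.1.2 (Set.mem_univ (s • v)) (Set.mem_univ (s' • v)) (zero_le (a := a))
    (zero_le (a := b)) (by exact_mod_cast hab)
  have e : a • s • v + b • s' • v = (a * s + b * s') • v := by
    rw [add_smul, mul_smul, mul_smul]; rfl
  rw [e] at this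
  refine this.trans ?_
  rw [ENNReal.ofReal_add (by positivity) (by positivity), ENNReal.ofReal_mul (by positivity),
    ENNReal.ofReal_mul (by positivity), ENNReal.ofReal_coe_nnreal, ENNReal.ofReal_coe_nnreal]
  simp only [ENNReal.smul_def, smul_eq_mul]
  gcongr

theorem lintegral_mul_radialVolume_le {n : ℕ} (hn : 0 < n)
    {φ : EuclideanSpace ℝ (Fin n) → ℝ≥0∞} (hφ : φ ∈ Cvx₀ n) {α M : ℝ} (hM : 0 < M)
    (H : ∀ g : ℝ → ℝ, ConcaveOn ℝ (Set.Ioi 0) g → (∀ t, 0 < t → 0 ≤ g t) → RatioLE α n M g)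
    (v : EuclideanSpace ℝ (Fin n)) :
    ∫⁻ t in Set.Ioi (0 : ℝ), ENNReal.ofReal (nuWeight α n t) * radialVolume φ v t ≤
      ENNReal.ofReal M *
        ∫⁻ t in Set.Ioi (0 : ℝ), ENNReal.ofReal (Real.exp (-t)) * radialVolume φ v t := by
  have h0 := hφ.2.2
  -- If all sublevel sets on the ray are bounded, their lengths form a concave `g` and the radial
  -- volume is `g^n / n`. Otherwise `φ` vanishes on the ray and the right-hand side is infinite.
  by_cases hb : ∀ t : ℝ, 0 < t → BddAbove {s : ℝ | 0 ≤ s ∧ φ (s • v) ≤ ENNReal.ofReal t}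
  · set S : ℝ → Set ℝ := fun t => {s : ℝ | 0 ≤ s ∧ φ (s • v) ≤ ENNReal.ofReal t} with hS
    set g : ℝ → ℝ := fun t => sSup (S t) with hg
    have hmem0 : ∀ t, (0 : ℝ) ∈ S t := fun t => ⟨le_rfl, by simp [h0]⟩
    have hg0 : ∀ t, 0 < t → 0 ≤ g t := fun t ht => le_csSup (hb t ht) (hmem0 t)
    have hconc : ConcaveOn ℝ (Set.Ioi 0) g := by
      refine ⟨convex_Ioi 0, fun t ht t' ht' a b ha hb' hab => ?_⟩
      have ht0 : 0 < t := ht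
      have ht0' : 0 < t' := ht'
      have htt : 0 < a * t + b * t' := convex_Ioi (0 : ℝ) ht ht' ha hb' hab
      simp only [smul_eq_mul]
      have key : ∀ s ∈ S t, ∀ s' ∈ S t', a * s + b * s' ≤ g (a * t + b * t') := by
        intro s hs s' hs'
        refine le_csSup (hb _ htt)
          ⟨add_nonneg (mul_nonneg ha hs.1) (mul_nonneg hb' hs'.1), ?_⟩
        exact convexOn_ray_le hφ v ha hb' hab ht0.le ht0'.le hs.2 hs'.2
      have key2 : ∀ s ∈ S t, a * s + b * g t' ≤ g (a * t + b * t') := by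
        intro s hs
        have : b * g t' ≤ g (a * t + b * t') - a * s := by
          rw [hg]
          simp only
          rw [← smul_eq_mul b, ← Real.sSup_smul_of_nonneg hb']
          refine csSup_le ⟨_, Set.smul_mem_smul_set (hmem0 t')⟩ ?_
          rintro _ ⟨s', hs', rfl⟩
          have := key s hs s' hs'
          simp only [smul_eq_mul]
          linarith
        linarith
      have : a * g t ≤ g (a * t + b * t') - b * g t' := by
        conv_lhs => rw [hg]
        simp only
        rw [← smul_eq_mul a, ← Real.sSup_smul_of_nonneg ha]
        refine csSup_le ⟨_, Set.smul_mem_smul_set (hmem0 t)⟩ ?_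
        rintro _ ⟨s, hs, rfl⟩
        have := key2 s hs
        simp only [smul_eq_mul]
        linarith
      linarith
    have hW : ∀ t, 0 < t → radialVolume φ v t = ENNReal.ofReal (1 / n) * ENNReal.ofReal (g t ^ n) := by
      intro t ht
      have hgt := hg0 t ht
      have e : ENNReal.ofReal (1 / n) * ENNReal.ofReal (g t ^ n) = ENNReal.ofReal (g t ^ n / n) := by
        rw [← ENNReal.ofReal_mul (by positivity)]; congr 1; ring
      rw [e, ← lintegral_Ioc_pow hn hgt]
      unfold radialVolume
      apply le_antisymm
      · rw [← MeasureTheory.lintegral_indicator measurableSet_Ioi,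
          ← MeasureTheory.lintegral_indicator measurableSet_Ioc]
        refine MeasureTheory.lintegral_mono fun s => ?_
        by_cases hs : 0 < s
        · by_cases hs2 : φ (s • v) ≤ ENNReal.ofReal t
          · have : s ≤ g t := le_csSup (hb t ht) ⟨hs.le, hs2⟩
            simp [Set.indicator, hs, hs2, this]
          · simp [Set.indicator, hs2]
        · simp [Set.indicator, hs]
      -- Dropping the endpoint avoids having to know that the supremum `g t` is attained.
      · rw [MeasureTheory.restrict_Ioo_eq_restrict_Ioc.symm,
          ← MeasureTheory.lintegral_indicator measurableSet_Ioi,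
          ← MeasureTheory.lintegral_indicator measurableSet_Ioo]
        refine MeasureTheory.lintegral_mono fun s => ?_
        by_cases hs : s ∈ Set.Ioo 0 (g t)
        · have hs2 : φ (s • v) ≤ ENNReal.ofReal t := by
            obtain ⟨s', hs', hlt⟩ := exists_lt_of_lt_csSup ⟨0, hmem0 t⟩ hs.2
            have hs0 : 0 < s' := hs.1.trans hlt
            have := convexOn_ray_le hφ v (a := s / s') (b := 1 - s / s') (s' := 0) (t' := t)
              (div_nonneg hs.1.le hs0.le) (sub_nonneg.2 ((div_le_one hs0).2 hlt.le)) (by ring)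
              ht.le ht.le hs'.2 (by simp [h0])
            have e1 : s / s' * s' + (1 - s / s') * 0 = s := by field_simp; ring
            have e2 : s / s' * t + (1 - s / s') * t = t := by ring
            rwa [e1, e2] at this
          rw [Set.indicator_of_mem hs, Set.indicator_of_mem (Set.mem_Ioi.2 hs.1)]
          simp [Set.indicator, hs2]
        · rw [Set.indicator_of_notMem hs]
          exact zero_le
    have hc : ∀ k : ℝ → ℝ,
        ∫⁻ t in Set.Ioi (0 : ℝ), ENNReal.ofReal (k t) * radialVolume φ v t =
        ENNReal.ofReal (1 / n) *
          ∫⁻ t in Set.Ioi (0 : ℝ), ENNReal.ofReal (k t) * ENNReal.ofReal (g t ^ n) := by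
      intro k
      rw [← MeasureTheory.lintegral_const_mul' _ _ ENNReal.ofReal_ne_top]
      refine MeasureTheory.setLIntegral_congr_fun measurableSet_Ioi fun t ht => ?_
      rw [hW t ht, mul_left_comm]
    rw [hc, hc, mul_left_comm]
    have := H g hconc hg0
    unfold RatioLE at this
    gcongr
  · push Not at hb
    obtain ⟨t₀, ht₀, hub⟩ := hb
    have hzero : ∀ t : ℝ, 0 < t → ∀ s : ℝ, 0 < s → φ (s • v) ≤ ENNReal.ofReal t := by
      intro t ht s hs
      rw [not_bddAbove_iff] at hub
      -- For `s'` beyond `s t₀ / t`, convexity and `φ 0 = 0` give `φ(s v) ≤ (s/s') t₀ ≤ t`.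
      obtain ⟨s', hs', hlt⟩ := hub (max s (s * t₀ / t))
      have hs1 : s < s' := (le_max_left _ _).trans_lt hlt
      have hs2 : s * t₀ / t < s' := (le_max_right _ _).trans_lt hlt
      have hs0 : 0 < s' := hs.trans hs1
      have := convexOn_ray_le hφ v (a := s / s') (b := 1 - s / s') (s' := 0) (t' := 0)
        (div_nonneg hs.le hs0.le) (sub_nonneg.2 ((div_le_one hs0).2 hs1.le)) (by ring)
        ht₀.le le_rfl hs'.2 (by simp [h0])
      have e1 : s / s' * s' + (1 - s / s') * 0 = s := by field_simp; ring
      rw [e1] at this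
      refine this.trans (ENNReal.ofReal_le_ofReal ?_)
      rw [div_lt_iff₀ ht] at hs2
      rw [mul_zero, add_zero, div_mul_eq_mul_div, div_le_iff₀ hs0]
      linarith
    have hW : ∀ t, 0 < t → radialVolume φ v t = ⊤ := by
      intro t ht
      unfold radialVolume
      rw [eq_top_iff]
      calc (⊤ : ℝ≥0∞) = ∫⁻ s in Set.Ioi (1 : ℝ), 1 := by simp
        _ ≤ ∫⁻ s in Set.Ioi (1 : ℝ), ENNReal.ofReal (s ^ (n - 1)) *
            Set.indicator {x | φ x ≤ ENNReal.ofReal t} 1 (s • v) := by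
          refine MeasureTheory.setLIntegral_mono' measurableSet_Ioi fun s hs => ?_
          have hs1 : 1 < s := hs
          have h2 := hzero t ht s (by linarith)
          have h3 : 1 ≤ s ^ (n - 1) := one_le_pow₀ hs1.le
          simpa [Set.indicator, h2] using h3
        _ ≤ _ := MeasureTheory.lintegral_mono_set (Set.Ioi_subset_Ioi zero_le_one)
    have : ∫⁻ t in Set.Ioi (0 : ℝ), ENNReal.ofReal (Real.exp (-t)) * radialVolume φ v t = ⊤ := by
      rw [MeasureTheory.setLIntegral_congr_fun (g := fun t => ENNReal.ofReal (Real.exp (-t)) * ⊤)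
        measurableSet_Ioi fun t ht => by simp only [hW t ht],
        MeasureTheory.lintegral_mul_const _ (by fun_prop)]
      have := lintegral_exp_neg_mul_pow 0
      simp only [pow_zero, ENNReal.ofReal_one, mul_one, Nat.factorial_zero, Nat.cast_one] at this
      rw [this, one_mul]
    rw [this, ENNReal.mul_top (by simpa using hM)]
    exact le_top

theorem integralExpNeg_gaugeTransform_le {n : ℕ} (hn : 0 < n)
    {φ : EuclideanSpace ℝ (Fin n) → ℝ≥0∞} (hφ : φ ∈ Cvx₀ n) {α M : ℝ} (hα : 0 < α) (hM : 0 < M)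
    (H : ∀ g : ℝ → ℝ, ConcaveOn ℝ (Set.Ioi 0) g → (∀ t, 0 < t → 0 ≤ g t) → RatioLE α n M g) :
    integralExpNeg (gaugeTransform α φ) ≤ ENNReal.ofReal M * integralExpNeg φ := by
  have hm := Cvx₀.measurable hφ
  rw [integralExpNeg_gaugeTransform hφ hα, integralExpNeg_eq_lintegral_volume hm,
    lintegral_volume_le_eq_lintegral_sphere hn hm (measurable_nuWeight α n),
    lintegral_volume_le_eq_lintegral_sphere hn hm (k := fun t => Real.exp (-t)) (by fun_prop),
    ← MeasureTheory.lintegral_const_mul' _ _ ENNReal.ofReal_ne_top]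
  exact MeasureTheory.lintegral_mono fun v => lintegral_mul_radialVolume_le hn hφ hM H v

/-! ### Existence of a maximizer -/

theorem levelRadius_le (r t₀ t : ℝ) : levelRadius r t₀ t ≤ t := min_le_left _ _

theorem measurable_levelRadius (r t₀ : ℝ) : Measurable (levelRadius r t₀) := by
  unfold levelRadius; fun_prop

theorem norm_mul_levelRadius_pow_le {k : ℝ → ℝ} (n : ℕ) {r t₀ t : ℝ} (hk0 : 0 ≤ k t)
    (hr : r ∈ Set.Icc (0 : ℝ) 1) (ht₀ : 0 < t₀)
    (ht : 0 < t) : ‖k t * levelRadius r t₀ t ^ n‖ ≤ k t * t ^ n := by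
  have h1 := levelRadius_pos hr ht₀ ht
  have h2 := levelRadius_le r t₀ t
  rw [Real.norm_of_nonneg (by positivity)]
  gcongr

section
variable {k : ℝ → ℝ} {n : ℕ} (hk : Measurable k) (hk0 : ∀ t, 0 < t → 0 < k t)
  (hint : MeasureTheory.IntegrableOn (fun t => k t * t ^ n) (Set.Ioi 0))
include hk hk0 hint

theorem integrableOn_mul_levelRadius_pow {r t₀ : ℝ} (hr : r ∈ Set.Icc (0 : ℝ) 1) (ht₀ : 0 < t₀) :
    MeasureTheory.IntegrableOn (fun t => k t * levelRadius r t₀ t ^ n) (Set.Ioi 0) := by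
  refine MeasureTheory.Integrable.mono' hint
    (hk.mul ((measurable_levelRadius r t₀).pow_const n)).aestronglyMeasurable ?_
  exact (MeasureTheory.ae_restrict_iff' measurableSet_Ioi).2
    (Filter.Eventually.of_forall fun t ht => norm_mul_levelRadius_pow_le n (hk0 t ht).le hr ht₀ ht)

theorem ofReal_integral_mul_levelRadius_pow {r t₀ : ℝ} (hr : r ∈ Set.Icc (0 : ℝ) 1)
    (ht₀ : 0 < t₀) :
    ENNReal.ofReal (∫ t in Set.Ioi (0 : ℝ), k t * levelRadius r t₀ t ^ n) =
      ∫⁻ t in Set.Ioi (0 : ℝ), ENNReal.ofReal (k t) * ENNReal.ofReal (levelRadius r t₀ t ^ n) := by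
  rw [MeasureTheory.ofReal_integral_eq_lintegral_ofReal
    (integrableOn_mul_levelRadius_pow hk hk0 hint hr ht₀)]
  · exact MeasureTheory.setLIntegral_congr_fun measurableSet_Ioi fun t ht =>
      ENNReal.ofReal_mul (hk0 t ht).le
  · refine (MeasureTheory.ae_restrict_iff' measurableSet_Ioi).2
      (Filter.Eventually.of_forall fun t ht => ?_)
    exact mul_nonneg (hk0 t ht).le (pow_nonneg (levelRadius_pos hr ht₀ ht).le n)

theorem integral_mul_levelRadius_pow_pos {r t₀ : ℝ} (hr : r ∈ Set.Icc (0 : ℝ) 1)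
    (ht₀ : 0 < t₀) : 0 < ∫ t in Set.Ioi (0 : ℝ), k t * levelRadius r t₀ t ^ n := by
  have hpos : ∀ t ∈ Set.Ioi (0 : ℝ), 0 < k t * levelRadius r t₀ t ^ n := fun t ht =>
    mul_pos (hk0 t ht) (pow_pos (levelRadius_pos hr ht₀ ht) n)
  rw [MeasureTheory.setIntegral_pos_iff_support_of_nonneg_ae
    ((MeasureTheory.ae_restrict_iff' measurableSet_Ioi).2
      (Filter.Eventually.of_forall fun t ht => (hpos t ht).le))
    (integrableOn_mul_levelRadius_pow hk hk0 hint hr ht₀)]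
  have hsub : Set.Ioi (0 : ℝ) ⊆ Function.support fun t => k t * levelRadius r t₀ t ^ n :=
    fun t ht => Function.mem_support.2 (hpos t ht).ne'
  rw [Set.inter_eq_right.2 hsub]
  simp

/-- Dominated convergence applies because `levelRadius r t₀ t ≤ t` uniformly in the parameters. -/
theorem continuousOn_integral_mul_levelRadius_pow {a c : ℝ} (ha : 0 < a) :
    ContinuousOn (fun p : ℝ × ℝ => ∫ t in Set.Ioi (0 : ℝ), k t * levelRadius p.1 p.2 t ^ n)
      (Set.Icc 0 1 ×ˢ Set.Icc a c) := by
  refine MeasureTheory.continuousOn_of_dominated (bound := fun t => k t * t ^ n) ?_ ?_ hint ?_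
  · exact fun p _ => (hk.mul ((measurable_levelRadius p.1 p.2).pow_const n)).aestronglyMeasurable
  · intro p hp
    exact (MeasureTheory.ae_restrict_iff' measurableSet_Ioi).2 (Filter.Eventually.of_forall
      fun t ht => norm_mul_levelRadius_pow_le n (hk0 t ht).le hp.1 (ha.trans_le hp.2.1) ht)
  · refine Filter.Eventually.of_forall fun t => Continuous.continuousOn ?_
    unfold levelRadius
    fun_prop

end

theorem integrableOn_of_lintegral_eq {k : ℝ → ℝ} {n : ℕ} (hk : Measurable k)
    (hk0 : ∀ t, 0 < t → 0 < k t) {I : ℝ}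
    (h : ∫⁻ t in Set.Ioi (0 : ℝ), ENNReal.ofReal (k t) * ENNReal.ofReal (t ^ n) =
      ENNReal.ofReal I) :
    MeasureTheory.IntegrableOn (fun t => k t * t ^ n) (Set.Ioi 0) := by
  have hae : 0 ≤ᵐ[MeasureTheory.volume.restrict (Set.Ioi 0)] fun t => k t * t ^ n :=
    (MeasureTheory.ae_restrict_iff' measurableSet_Ioi).2 (Filter.Eventually.of_forall
      fun t ht => mul_nonneg (hk0 t ht).le (pow_nonneg (le_of_lt ht) n))
  refine (MeasureTheory.lintegral_ofReal_ne_top_iff_integrable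
    (Measurable.aestronglyMeasurable (by fun_prop)) hae).1 ?_
  rw [MeasureTheory.setLIntegral_congr_fun measurableSet_Ioi fun t ht =>
    ENNReal.ofReal_mul (hk0 t ht).le, h]
  exact ENNReal.ofReal_ne_top

theorem nuWeight_pos {α : ℝ} (hα : 0 < α) (n : ℕ) {t : ℝ} (ht : 0 < t) : 0 < nuWeight α n t := by
  unfold nuWeight; positivity

theorem exists_maximizer {α t₁ t₂ : ℝ} {n : ℕ} (h1 : 0 < t₁) (h12 : t₁ ≤ t₂)
    (hsum : t₁ + t₂ = n + 2) (hprod : t₁ * t₂ = α) :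
    ∃ r ∈ Set.Icc (0 : ℝ) 1, ∃ t₀ : ℝ, 0 < t₀ ∧ ∃ M B : ℝ, 0 < M ∧ 0 < B ∧
      ∫⁻ t in Set.Ioi (0 : ℝ), ENNReal.ofReal (Real.exp (-t)) *
        ENNReal.ofReal (levelRadius r t₀ t ^ n) = ENNReal.ofReal B ∧
      ∫⁻ t in Set.Ioi (0 : ℝ), ENNReal.ofReal (nuWeight α n t) *
        ENNReal.ofReal (levelRadius r t₀ t ^ n) = ENNReal.ofReal (M * B) ∧
      ∀ g : ℝ → ℝ, ConcaveOn ℝ (Set.Ioi 0) g → (∀ t, 0 < t → 0 ≤ g t) → RatioLE α n M g := by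
  have h2 := h1.trans_le h12
  have hα : 0 < α := hprod ▸ mul_pos h1 h2
  have hf : (0 : ℝ) < n.factorial := by exact_mod_cast n.factorial_pos
  have hνm := measurable_nuWeight α n
  have hν0 : ∀ t, 0 < t → 0 < nuWeight α n t := fun t ht => nuWeight_pos hα n ht
  have hνi := integrableOn_of_lintegral_eq (I := 1) hνm hν0
    (by rw [lintegral_nuWeight_mul_pow hα, ENNReal.ofReal_one])
  have hμm : Measurable fun t : ℝ => Real.exp (-t) := by fun_prop
  have hμ0 : ∀ t : ℝ, 0 < t → 0 < Real.exp (-t) := fun t _ => Real.exp_pos _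
  have hμi := integrableOn_of_lintegral_eq hμm hμ0 (lintegral_exp_neg_mul_pow n)
  -- The parameter rectangle is fixed before `M` is known. The final `M` is at least `1/n!`, the
  -- value at `r = 1`, so `a₀` lies below the level `M`; `c₀` exceeds the local maximum, the largest
  -- level with three crossings.
  obtain ⟨a₀, ha0, ha1, ha⟩ := exists_small_weightRatio_le hα n (inv_pos.2 hf) h1
  obtain ⟨c₀, hc1, hc⟩ := exists_large_weightRatio_ge hα n (weightRatio α n t₁) t₂
  have hac : a₀ ≤ c₀ := ha1.trans (h12.trans hc1)
  set A : ℝ × ℝ → ℝ := fun p => ∫ t in Set.Ioi (0 : ℝ), nuWeight α n t * levelRadius p.1 p.2 t ^ n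
    with hA
  set B : ℝ × ℝ → ℝ := fun p => ∫ t in Set.Ioi (0 : ℝ), Real.exp (-t) * levelRadius p.1 p.2 t ^ n
    with hB
  have hBpos : ∀ p ∈ Set.Icc (0 : ℝ) 1 ×ˢ Set.Icc a₀ c₀, 0 < B p := fun p hp =>
    integral_mul_levelRadius_pow_pos hμm hμ0 hμi hp.1 (ha0.trans_le hp.2.1)
  have hcont : ContinuousOn (fun p => A p / B p) (Set.Icc (0 : ℝ) 1 ×ˢ Set.Icc a₀ c₀) :=
    (continuousOn_integral_mul_levelRadius_pow hνm hν0 hνi ha0).div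
      (continuousOn_integral_mul_levelRadius_pow hμm hμ0 hμi ha0) fun p hp => (hBpos p hp).ne'
  obtain ⟨p, hp, hmax⟩ := (isCompact_Icc.prod isCompact_Icc).exists_isMaxOn
    ⟨((1 : ℝ), a₀), ⟨zero_le_one, le_rfl⟩, ⟨le_rfl, hac⟩⟩ hcont
  have hp2 : 0 < p.2 := ha0.trans_le hp.2.1
  have hfacts : ∀ q ∈ Set.Icc (0 : ℝ) 1 ×ˢ Set.Icc a₀ c₀,
      (∫⁻ t in Set.Ioi (0 : ℝ), ENNReal.ofReal (Real.exp (-t)) *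
        ENNReal.ofReal (levelRadius q.1 q.2 t ^ n) = ENNReal.ofReal (B q)) ∧
      (∫⁻ t in Set.Ioi (0 : ℝ), ENNReal.ofReal (nuWeight α n t) *
        ENNReal.ofReal (levelRadius q.1 q.2 t ^ n) = ENNReal.ofReal (A q)) := fun q hq =>
    ⟨(ofReal_integral_mul_levelRadius_pow hμm hμ0 hμi hq.1 (ha0.trans_le hq.2.1)).symm,
      (ofReal_integral_mul_levelRadius_pow hνm hν0 hνi hq.1 (ha0.trans_le hq.2.1)).symm⟩
  have hMn : 1 ≤ A p / B p * n.factorial := by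
    have hq : ((1 : ℝ), a₀) ∈ Set.Icc (0 : ℝ) 1 ×ˢ Set.Icc a₀ c₀ :=
      ⟨⟨zero_le_one, le_rfl⟩, ⟨le_rfl, hac⟩⟩
    have hlr : ∀ t, levelRadius 1 a₀ t = t := fun t => by simp [levelRadius]
    obtain ⟨e1, e2⟩ := hfacts _ hq
    simp only [hlr] at e1 e2
    rw [lintegral_exp_neg_mul_pow, ENNReal.ofReal_eq_ofReal_iff hf.le (hBpos _ hq).le] at e1
    rw [lintegral_nuWeight_mul_pow hα, eq_comm, ENNReal.ofReal_eq_one] at e2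
    have h : A ((1 : ℝ), a₀) / B ((1 : ℝ), a₀) ≤ A p / B p := hmax hq
    rw [e2, ← e1, div_le_iff₀ hf] at h
    exact h
  have hMpos : 0 < A p / B p := by
    by_contra! h
    have := mul_nonpos_of_nonpos_of_nonneg h hf.le
    linarith
  have hMf : (n.factorial : ℝ)⁻¹ ≤ A p / B p := by rwa [inv_le_iff_one_le_mul₀ hf]
  refine ⟨p.1, hp.1, p.2, hp2, A p / B p, B p, hMpos, hBpos p hp, (hfacts p hp).1, ?_, ?_⟩
  · rw [(hfacts p hp).2, div_mul_cancel₀ _ (hBpos p hp).ne']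
  · intro g hg hg0
    refine ratioLE_of_levelRadius h1 h12 hsum hprod hMn ha0 ha1 hc1 (ha.trans hMf) hc
      (fun r hr t₀ ht₀ => ?_) hg hg0
    have hq : (r, t₀) ∈ Set.Icc (0 : ℝ) 1 ×ˢ Set.Icc a₀ c₀ := ⟨hr, ht₀⟩
    obtain ⟨e1, e2⟩ := hfacts _ hq
    unfold RatioLE
    simp only at e1 e2
    rw [e1, e2, ← ENNReal.ofReal_mul hMpos.le]
    refine ENNReal.ofReal_le_ofReal ?_
    have h : A (r, t₀) / B (r, t₀) ≤ A p / B p := hmax hq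
    rwa [div_le_iff₀ (hBpos _ hq)] at h

/-! ### Bounds for the maximum -/

theorem concaveOn_levelRadius (r t₀ : ℝ) : ConcaveOn ℝ (Set.Ioi 0) (levelRadius r t₀) := by
  refine (concaveOn_id (convex_Ioi 0)).inf ⟨convex_Ioi 0, fun x _ y _ a b _ _ hab => le_of_eq ?_⟩
  simp only [smul_eq_mul]
  linear_combination (1 - r) * t₀ * hab

/-- Truncation at `L` affects only `t > L`, where `t^n ≤ n! 2^n e^{t/2}` bounds the tail of `∫
e^{-t} t^n = n!`. -/
theorem factorial_le_lintegral_min_add (n : ℕ) {L : ℝ} (hL : 0 < L) :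
    ENNReal.ofReal n.factorial ≤
      (∫⁻ t in Set.Ioi (0 : ℝ), ENNReal.ofReal (Real.exp (-t)) * ENNReal.ofReal (min L t ^ n)) +
        ENNReal.ofReal (n.factorial * (2 ^ (n + 1) * Real.exp (-(L / 2)))) := by
  have hint : ∫⁻ t in Set.Ioi L, ENNReal.ofReal (n.factorial * 2 ^ n * Real.exp (-(1 / 2) * t)) =
      ENNReal.ofReal (n.factorial * (2 ^ (n + 1) * Real.exp (-(L / 2)))) := by
    rw [← MeasureTheory.ofReal_integral_eq_lintegral_ofReal
      ((integrableOn_exp_mul_Ioi (by norm_num : (-(1 / 2) : ℝ) < 0) L).const_mul _)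
      (Filter.Eventually.of_forall fun t => by simp only [Pi.zero_apply]; positivity),
      MeasureTheory.integral_const_mul, integral_exp_mul_Ioi (by norm_num) L]
    congr 1
    rw [show -(1 / 2) * L = -(L / 2) by ring]
    ring
  rw [← hint, ← lintegral_exp_neg_mul_pow,
    ← MeasureTheory.lintegral_inter_add_sdiff (B := Set.Ioi L) _ _ measurableSet_Ioi, add_comm]
  refine add_le_add ?_ ?_
  · refine le_trans ?_ (MeasureTheory.lintegral_mono_set (Set.sdiff_subset (t := Set.Ioi L)))
    refine MeasureTheory.setLIntegral_mono' (measurableSet_Ioi.diff measurableSet_Ioi) fun t ht => ?_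
    have : t ≤ L := not_lt.1 ht.2
    rw [min_eq_right this]
  · rw [Set.inter_eq_right.2 (Set.Ioi_subset_Ioi hL.le)]
    refine MeasureTheory.setLIntegral_mono' measurableSet_Ioi fun t ht => ?_
    have ht0 : 0 < t := hL.trans ht
    rw [← ENNReal.ofReal_mul (by positivity)]
    refine ENNReal.ofReal_le_ofReal ?_
    have h := Real.pow_div_factorial_le_exp (t / 2) (by positivity) n
    rw [div_le_iff₀ (by positivity), div_pow, div_le_iff₀ (by positivity)] at h
    have e : Real.exp (-t) * Real.exp (t / 2) = Real.exp (-(1 / 2) * t) := by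
      rw [← Real.exp_add]; congr 1; ring
    calc Real.exp (-t) * t ^ n
        ≤ Real.exp (-t) * (Real.exp (t / 2) * n.factorial * 2 ^ n) := by gcongr
      _ = n.factorial * 2 ^ n * (Real.exp (-t) * Real.exp (t / 2)) := by ring
      _ = _ := by rw [e]

/-- Replacing `min t ε` by `ε` would give `ε^n`. For `t ≤ ε/2` the integrand is smaller by at least
`ε^n / 4`, since `e^{-t} ≥ 1/2`, saving `ε^n · ε/8` in all. -/
theorem lintegral_exp_neg_mul_min_pow_le {n : ℕ} (hn : 0 < n) {ε : ℝ} (hε : 0 < ε) (hε1 : ε ≤ 1) :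
    ∫⁻ t in Set.Ioi (0 : ℝ), ENNReal.ofReal (Real.exp (-t)) * ENNReal.ofReal (min t ε ^ n) ≤
      ENNReal.ofReal (ε ^ n * (1 - ε / 8)) := by
  have h1 : (∫⁻ t in Set.Ioi (0 : ℝ), ENNReal.ofReal (Real.exp (-t)) *
      ENNReal.ofReal (min t ε ^ n)) +
      ∫⁻ t in Set.Ioc (0 : ℝ) (ε / 2), ENNReal.ofReal (ε ^ n / 4) ≤ ENNReal.ofReal (ε ^ n) := by
    have e : ENNReal.ofReal (ε ^ n) =
        ∫⁻ t in Set.Ioi (0 : ℝ), ENNReal.ofReal (Real.exp (-t)) * ENNReal.ofReal (ε ^ n) := by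
      rw [MeasureTheory.lintegral_mul_const' _ _ ENNReal.ofReal_ne_top]
      have := lintegral_exp_neg_mul_pow 0
      simp only [pow_zero, ENNReal.ofReal_one, mul_one, Nat.factorial_zero, Nat.cast_one] at this
      rw [this, one_mul]
    rw [e, ← Set.inter_eq_left.2 (Set.Ioc_subset_Ioi_self (α := ℝ) : Set.Ioc 0 (ε / 2) ⊆ Set.Ioi 0),
      ← MeasureTheory.Measure.restrict_restrict measurableSet_Ioc,
      ← MeasureTheory.lintegral_indicator measurableSet_Ioc,
      ← MeasureTheory.lintegral_add_left (by fun_prop)]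
    refine MeasureTheory.setLIntegral_mono' measurableSet_Ioi fun t ht => ?_
    have ht : 0 < t := ht
    by_cases htε : t ≤ ε / 2
    · rw [Set.indicator_of_mem (by exact ⟨ht, htε⟩), ← ENNReal.ofReal_mul (by positivity),
        ← ENNReal.ofReal_mul (by positivity), ← ENNReal.ofReal_add (by positivity) (by positivity)]
      refine ENNReal.ofReal_le_ofReal ?_
      have h2 : min t ε ^ n ≤ ε ^ n / 2 := by
        calc min t ε ^ n ≤ (ε * (1 / 2)) ^ n := by
              refine pow_le_pow_left₀ (by positivity) ((min_le_left _ _).trans (by linarith)) n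
          _ = ε ^ n * (1 / 2) ^ n := mul_pow _ _ _
          _ ≤ ε ^ n * (1 / 2) := by
              gcongr
              exact pow_le_of_le_one (by norm_num) (by norm_num) hn.ne'
          _ = _ := by ring
      have h3 : (1 : ℝ) / 2 ≤ Real.exp (-t) := by
        have := Real.add_one_le_exp (-t)
        linarith
      have h4 : 0 < ε ^ n := by positivity
      nlinarith
    · rw [Set.indicator_of_notMem (by exact fun h => htε h.2), add_zero]
      gcongr
      exact min_le_right _ _
  have h2 : ∫⁻ t in Set.Ioc (0 : ℝ) (ε / 2), ENNReal.ofReal (ε ^ n / 4) =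
      ENNReal.ofReal (ε ^ n * (ε / 8)) := by
    rw [MeasureTheory.setLIntegral_const, Real.volume_Ioc, ← ENNReal.ofReal_mul (by positivity)]
    congr 1; ring
  rw [h2] at h1
  have h3 := ENNReal.le_sub_of_add_le_right ENNReal.ofReal_ne_top h1
  rwa [← ENNReal.ofReal_sub _ (by positivity), ← mul_one_sub] at h3

theorem lintegral_nuWeight_mul_min_pow {α ε : ℝ} (n : ℕ) (hα : 0 < α) (hε : 0 < ε) :
    ∫⁻ t in Set.Ioi (0 : ℝ), ENNReal.ofReal (nuWeight α n t) * ENNReal.ofReal (min t ε ^ n) =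
      ENNReal.ofReal ((ε / α) ^ n) * ∫⁻ t in Set.Ioi (0 : ℝ), ENNReal.ofReal (Real.exp (-t)) *
        ENNReal.ofReal (min (α / ε) t ^ n) := by
  rw [lintegral_Ioi_comp_const_div hα, ← MeasureTheory.lintegral_const_mul' _ _ ENNReal.ofReal_ne_top]
  refine MeasureTheory.setLIntegral_congr_fun measurableSet_Ioi fun t ht => ?_
  have ht : 0 < t := ht
  have e : min (α / t) ε = ε / t * min (α / ε) t := by
    rw [mul_min_of_nonneg _ _ (by positivity)]
    congr 1 <;> field_simp
  have h0 : 0 < min (α / ε) t := lt_min (by positivity) ht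
  have e2 : α / (α / t) = t := by field_simp
  rw [e, ← ENNReal.ofReal_mul (nuWeight_nonneg hα n (by positivity)),
    ← ENNReal.ofReal_mul (by positivity), ← ENNReal.ofReal_mul (by positivity),
    ← ENNReal.ofReal_mul (by positivity), mul_pow (ε / t), nuWeight, e2, pow_add, div_pow α,
    div_pow ε, div_pow ε]
  congr 1
  field_simp

/-- Testing with `g = min(t, ε)` gives `n! (1 - δ) ≤ M α^n (1 - ε/8)`, where `δ` is the tail beyond
`α/ε`. For `ε = 1/(20n)` one has `δ ≤ ε/32`, which leaves a gain of `ε/16 = 1/(320 n)`. -/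
theorem one_add_le_of_ratioLE {n : ℕ} (hn : 0 < n) {α M : ℝ} (hα : 1 ≤ α) (hM : 0 < M)
    (H : ∀ g : ℝ → ℝ, ConcaveOn ℝ (Set.Ioi 0) g → (∀ t, 0 < t → 0 ≤ g t) → RatioLE α n M g) :
    1 + 1 / 320 / (n : ℝ) ≤ M * α ^ n / n.factorial := by
  have hα0 : 0 < α := by linarith
  have hn1 : (1 : ℝ) ≤ n := by exact_mod_cast hn
  have hf : (0 : ℝ) < n.factorial := by exact_mod_cast n.factorial_pos
  set ε : ℝ := 1 / (20 * n) with hε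
  have hε0 : 0 < ε := by positivity
  have hε1 : ε ≤ 1 := by rw [hε, div_le_one (by positivity)]; linarith
  set δ : ℝ := 2 ^ (n + 1) * Real.exp (-(α / ε / 2)) with hδ
  have hδ0 : 0 < δ := by positivity
  have hδε : δ ≤ ε / 32 := by
    have h1 : Real.exp (-(α / ε / 2)) ≤ Real.exp (-10) ^ n := by
      rw [← Real.exp_nat_mul]
      refine Real.exp_le_exp.2 ?_
      have : α / ε / 2 = 10 * n * α := by rw [hε]; field_simp; norm_num
      rw [this]
      nlinarith
    have h2 : Real.exp (-10) ≤ 1 / 8000 := by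
      rw [Real.exp_neg, ← one_div]
      refine one_div_le_one_div_of_le (by norm_num) ?_
      have h3 : (2.7 : ℝ) ≤ Real.exp 1 := by linarith [Real.exp_one_gt_d9]
      calc (8000 : ℝ) ≤ 2.7 ^ 10 := by norm_num
        _ ≤ Real.exp 1 ^ 10 := by gcongr
        _ = Real.exp 10 := by rw [← Real.exp_nat_mul]; norm_num
    have h3 : (n : ℝ) ≤ 2 ^ n := by exact_mod_cast (Nat.lt_two_pow_self (n := n)).le
    calc δ ≤ 2 ^ (n + 1) * (1 / 8000) ^ n := by
          rw [hδ]
          gcongr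
          exact h1.trans (pow_le_pow_left₀ (Real.exp_pos _).le h2 n)
      _ = 2 * (1 / 2) ^ n * (1 / 2000) ^ n := by
          rw [pow_succ, mul_assoc, mul_assoc, ← mul_pow, mul_comm (2 ^ n), mul_assoc, ← mul_pow]
          norm_num
      _ ≤ 2 * (1 / n) * (1 / 2000) := by
          gcongr
          · rw [one_div_pow]; exact one_div_le_one_div_of_le (by positivity) h3
          · exact pow_le_of_le_one (by norm_num) (by norm_num) hn.ne'
      _ ≤ ε / 32 := by
          rw [hε, div_div, show 2 * (1 / (n : ℝ)) * (1 / 2000) = 1 / (1000 * n) by field_simp; norm_num]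
          refine one_div_le_one_div_of_le (by positivity) ?_
          nlinarith
  have hg := H _ (concaveOn_levelRadius 0 ε)
    fun t ht => (levelRadius_pos ⟨le_rfl, zero_le_one⟩ hε0 ht).le
  have hlr : ∀ t, levelRadius 0 ε t = min t ε := fun t => by simp [levelRadius]
  unfold RatioLE at hg
  simp only [hlr] at hg
  rw [lintegral_nuWeight_mul_min_pow n hα0 hε0] at hg
  have h1 := factorial_le_lintegral_min_add n (div_pos hα0 hε0)
  rw [← hδ] at h1
  have h2 := tsub_le_iff_right.2 h1
  rw [← ENNReal.ofReal_sub _ (by positivity), ← mul_one_sub] at h2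
  have h3 : ENNReal.ofReal ((ε / α) ^ n) * ENNReal.ofReal (n.factorial * (1 - δ)) ≤
      ENNReal.ofReal M * ENNReal.ofReal (ε ^ n * (1 - ε / 8)) :=
    (mul_le_mul_right h2 _).trans (hg.trans
      (mul_le_mul_right (lintegral_exp_neg_mul_min_pow_le hn hε0 hε1) _))
  have h8 : 0 < 1 - ε / 8 := by linarith
  rw [← ENNReal.ofReal_mul (by positivity), ← ENNReal.ofReal_mul hM.le,
    ENNReal.ofReal_le_ofReal_iff (by positivity), div_pow, div_mul_eq_mul_div,
    div_le_iff₀ (by positivity)] at h3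
  have h4 : n.factorial * (1 - δ) ≤ M * α ^ n * (1 - ε / 8) := by
    have hp : 0 < ε ^ n := by positivity
    refine le_of_mul_le_mul_left ?_ hp
    calc ε ^ n * (n.factorial * (1 - δ)) ≤ M * (ε ^ n * (1 - ε / 8)) * α ^ n := h3
      _ = _ := by ring
  have h5 : 1 / 320 / (n : ℝ) = ε / 16 := by rw [hε]; field_simp; norm_num
  rw [h5, le_div_iff₀ hf]
  have h6 : (1 + ε / 16) * (1 - ε / 8) ≤ 1 - δ := by nlinarith
  have h7 : (1 + ε / 16) * n.factorial * (1 - ε / 8) ≤ M * α ^ n * (1 - ε / 8) := by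
    calc (1 + ε / 16) * n.factorial * (1 - ε / 8)
        = n.factorial * ((1 + ε / 16) * (1 - ε / 8)) := by ring
      _ ≤ n.factorial * (1 - δ) := by gcongr
      _ ≤ _ := h4
  exact le_of_mul_le_mul_right h7 h8

theorem rho_spec (n : ℕ) (hn : 0 < n) : rho n hn ∈ Set.Ioo (0 : ℝ) (1 / 4) ∧
    q n (4 * rho n hn) =
      (2 * ((n.factorial : ℝ) ^ (1 / (n : ℝ))) / ((n : ℝ) + 2)) ^ ((n : ℝ) / ((n : ℝ) + 2)) :=
  (existsUnique_rho n hn).choose_spec.1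

theorem weightRatio_eq {α t₁ t₂ : ℝ} (n : ℕ) (h1 : 0 < t₁) (hprod : t₁ * t₂ = α) :
    weightRatio α n t₁ = α / t₁ ^ (n + 2) * Real.exp (t₁ - t₂) := by
  have : α / t₁ = t₂ := by rw [← hprod]; field_simp
  rw [weightRatio, nuWeight, this, mul_assoc, ← Real.exp_add]
  congr 2; ring

/-- The roots of `t² - (n+2) t + α`; the bound `α < ρ_n (n+2)²` says that the quotient of the
weights exceeds `1 / n!` at the smaller one. -/
theorem exists_roots {n : ℕ} (hn : 0 < n) {α : ℝ} (hα : 0 < α)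
    (hαρ : α < rho n hn * ((n : ℝ) + 2) ^ 2) :
    ∃ t₁ t₂ : ℝ, 0 < t₁ ∧ t₁ ≤ t₂ ∧ t₁ + t₂ = n + 2 ∧ t₁ * t₂ = α ∧
      1 ≤ weightRatio α n t₁ * n.factorial := by
  obtain ⟨⟨hρ0, hρ1⟩, hρ⟩ := rho_spec n hn
  have hn0 : (0 : ℝ) < n := by exact_mod_cast hn
  have hf : (0 : ℝ) < n.factorial := by exact_mod_cast n.factorial_pos
  set N : ℝ := (n : ℝ) + 2 with hN
  have hN0 : 0 < N := by positivity
  set x : ℝ := 4 * α / N ^ 2 with hx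
  have hx0 : 0 < x := by positivity
  have hxρ : x < 4 * rho n hn := by
    rw [hx, div_lt_iff₀ (by positivity)]; linarith
  have hx1 : x < 1 := by linarith
  set s : ℝ := √(1 - x) with hs
  have hs0 : 0 ≤ s := Real.sqrt_nonneg _
  have hsq : s ^ 2 = 1 - x := Real.sq_sqrt (by linarith)
  have hs1 : s < 1 := by nlinarith
  have h1 : 0 < N * (1 - s) / 2 := by
    have : 0 < 1 - s := by linarith
    positivity
  have hprod : N * (1 - s) / 2 * (N * (1 + s) / 2) = α := by
    have : N * (1 - s) / 2 * (N * (1 + s) / 2) = N ^ 2 * (1 - s ^ 2) / 4 := by ring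
    rw [this, hsq, hx]; field_simp; ring
  refine ⟨N * (1 - s) / 2, N * (1 + s) / 2, h1, by nlinarith, by ring, hprod, ?_⟩
  have hq : q n x < q n (4 * rho n hn) :=
    q_strictMono n ⟨hx0, hx1.le⟩ ⟨by linarith, by linarith⟩ hxρ
  have hs1' : 0 < 1 - s := by linarith
  have hq0 : 0 < q n x := by
    have := Real.rpow_pos_of_pos hx0 (-(1 / ((n : ℝ) + 2)))
    unfold q; positivity
  -- The `(n+2)`-th power removes the roots from both sides of `q(x) < q(4ρ_n)`; the result is `1 ≤
  -- w(t₁) n!` in the variables `x` and `s`.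
  have hpow : q n x ^ (n + 2) ≤ (2 / N) ^ n * n.factorial := by
    refine (pow_le_pow_left₀ hq0.le hq.le (n + 2)).trans (le_of_eq ?_)
    have hb : 0 ≤ 2 * ((n.factorial : ℝ) ^ (1 / (n : ℝ))) / N := by positivity
    rw [hρ, ← Real.rpow_natCast, ← Real.rpow_mul hb]
    have : (n : ℝ) / N * ((n + 2 : ℕ) : ℝ) = n := by
      push_cast; rw [← hN]; field_simp
    rw [this, Real.rpow_natCast, mul_div_right_comm, mul_pow, one_div,
      Real.rpow_inv_natCast_pow hf.le hn.ne']
  have hqpow : q n x ^ (n + 2) = (1 - s) ^ (n + 2) / x * Real.exp (N * s) := by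
    unfold q
    rw [← hs, mul_pow, mul_pow, ← Real.rpow_natCast (x ^ _), ← Real.rpow_mul hx0.le,
      ← Real.exp_nat_mul]
    have e1 : -(1 / ((n : ℝ) + 2)) * ((n + 2 : ℕ) : ℝ) = -1 := by push_cast; field_simp
    have e2 : ((n + 2 : ℕ) : ℝ) = N := by push_cast; rw [hN]
    rw [e1, e2, Real.rpow_neg_one, div_eq_mul_inv]
  rw [hqpow] at hpow
  rw [weightRatio_eq n h1 hprod, show N * (1 - s) / 2 - N * (1 + s) / 2 = -(N * s) by ring,
    Real.exp_neg]
  have hαx : α = x * N ^ 2 / 4 := by rw [hx]; field_simp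
  have e3 : α / (N * (1 - s) / 2) ^ (n + 2) * (Real.exp (N * s))⁻¹ * n.factorial =
      ((2 / N) ^ n * n.factorial) / ((1 - s) ^ (n + 2) / x * Real.exp (N * s)) := by
    have : (N * (1 - s) / 2) ^ (n + 2) = N ^ n * N ^ 2 / (2 ^ n * 4) * (1 - s) ^ (n + 2) := by
      rw [div_pow, mul_pow, pow_add N, pow_add 2]; ring
    rw [this, hαx, div_pow]
    field_simp
  rw [e3, one_le_div (by positivity)]
  exact hpow

/-- With `α = t₁ t₂` the left side is `(t₂^{n+1} e^{-t₂} / n!) · (1/t₁) · e^{t₁}`. The first factor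
is at most `√(n+1)` by Stirling; `1/t₁ ≤ n + 2` because `t₁ t₂ ≥ 1`; and `t₁ ≤ 2α/n` because `t₂ ≥
n/2`. Then `√(n+1) ≤ 2√n` and `n + 2 ≤ 3n` give the `6`. -/
theorem weightRatio_mul_le {α t₁ t₂ : ℝ} {n : ℕ} (hn : 0 < n) (h1 : 0 < t₁) (h12 : t₁ ≤ t₂)
    (hsum : t₁ + t₂ = n + 2) (hprod : t₁ * t₂ = α) (hα : 1 ≤ α) :
    weightRatio α n t₁ * α ^ n / n.factorial ≤
      6 * (n : ℝ) * √(n : ℝ) * Real.exp (2 * α / (n : ℝ)) := by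
  have h2 := h1.trans_le h12
  have hn1 : (1 : ℝ) ≤ n := by exact_mod_cast hn
  have hf : (0 : ℝ) < n.factorial := by exact_mod_cast n.factorial_pos
  have e1 : weightRatio α n t₁ * α ^ n / n.factorial =
      t₂ ^ (n + 1) * Real.exp (-t₂) / n.factorial * (1 / t₁) * Real.exp t₁ := by
    rw [weightRatio_eq n h1 hprod, sub_eq_add_neg, Real.exp_add, ← hprod, mul_pow, pow_add t₁,
      pow_succ t₂]
    field_simp
  have b1 : 1 / t₁ ≤ n + 2 := by
    rw [div_le_iff₀ h1]
    nlinarith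
  have b2 : Real.exp t₁ ≤ Real.exp (2 * α / n) := by
    refine Real.exp_le_exp.2 ?_
    rw [le_div_iff₀ (by linarith), ← hprod]
    nlinarith
  have b3 : t₂ ^ (n + 1) * Real.exp (-t₂) / n.factorial ≤ √((n : ℝ) + 1) := by
    -- The function `t^{n+1} e^{-t}` is largest at `t = n + 1`; this follows from `x ≤ e^{x-1}` at
    -- `x = t₂/(n+1)`.
    have h3 : t₂ ^ (n + 1) * Real.exp (-t₂) ≤ (((n : ℝ) + 1) / Real.exp 1) ^ (n + 1) := by
      have h4 : t₂ / (n + 1) ≤ Real.exp (t₂ / (n + 1) - 1) := by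
        have := Real.add_one_le_exp (t₂ / (n + 1) - 1)
        linarith
      have h5 : t₂ * Real.exp (-(t₂ / (n + 1))) ≤ ((n : ℝ) + 1) / Real.exp 1 := by
        rw [Real.exp_sub, div_le_div_iff₀ (by positivity) (by positivity)] at h4
        rw [Real.exp_neg, ← div_eq_mul_inv, div_le_div_iff₀ (by positivity) (by positivity)]
        linarith
      have h6 := pow_le_pow_left₀ (by positivity) h5 (n + 1)
      rw [mul_pow, ← Real.exp_nat_mul] at h6
      have e : ((n + 1 : ℕ) : ℝ) * -(t₂ / (n + 1)) = -t₂ := by push_cast; field_simp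
      rwa [e] at h6
    have h7 := Stirling.le_factorial_stirling (n + 1)
    push_cast [Nat.factorial_succ] at h7
    have h8 : √((n : ℝ) + 1) ≤ √(2 * Real.pi * (n + 1)) := by
      refine Real.sqrt_le_sqrt ?_
      nlinarith [Real.pi_gt_three]
    have h9 : √((n : ℝ) + 1) * √((n : ℝ) + 1) = n + 1 := Real.mul_self_sqrt (by positivity)
    have h10 : 0 < √((n : ℝ) + 1) := Real.sqrt_pos.2 (by positivity)
    rw [div_le_iff₀ hf]
    refine le_of_mul_le_mul_left ?_ h10
    calc √((n : ℝ) + 1) * (t₂ ^ (n + 1) * Real.exp (-t₂))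
        ≤ √(2 * Real.pi * (n + 1)) * (((n : ℝ) + 1) / Real.exp 1) ^ (n + 1) := by gcongr
      _ ≤ (n + 1) * n.factorial := h7
      _ = _ := by rw [← mul_assoc, h9]
  have b4 : √((n : ℝ) + 1) ≤ 2 * √(n : ℝ) := by
    rw [Real.sqrt_le_left (by positivity), mul_pow, Real.sq_sqrt (by positivity)]
    linarith
  rw [e1]
  calc t₂ ^ (n + 1) * Real.exp (-t₂) / n.factorial * (1 / t₁) * Real.exp t₁
      ≤ (2 * √(n : ℝ)) * (3 * n) * Real.exp (2 * α / n) := by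
        gcongr
        · exact b3.trans b4
        · linarith
    _ = _ := by ring

/-! ### The extremal functions -/

theorem lintegral_mul_volume_psi {n : ℕ} {K : ConvexBody (EuclideanSpace ℝ (Fin n))}
    (hK : (0 : EuclideanSpace ℝ (Fin n)) ∈ interior (K : Set (EuclideanSpace ℝ (Fin n))))
    {r t₀ : ℝ} (hr : r ∈ Set.Icc (0 : ℝ) 1) (ht₀ : 0 < t₀) (k : ℝ → ℝ) :
    ∫⁻ t in Set.Ioi (0 : ℝ), ENNReal.ofReal (k t) *
        MeasureTheory.volume {x | psi K r t₀ x ≤ ENNReal.ofReal t} =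
      (∫⁻ t in Set.Ioi (0 : ℝ), ENNReal.ofReal (k t) * ENNReal.ofReal (levelRadius r t₀ t ^ n)) *
        MeasureTheory.volume (K : Set (EuclideanSpace ℝ (Fin n))) := by
  rw [← MeasureTheory.lintegral_mul_const' _ _ K.isCompact.measure_lt_top.ne]
  refine MeasureTheory.setLIntegral_congr_fun measurableSet_Ioi fun t ht => ?_
  rw [volume_psi_le hK hr ht₀ ht, mul_assoc]

/-- A bound `∫ e^{-𝒥φ} ≤ M ∫ e^{-φ}` for all `φ` gives a reverse bound through `𝒥`. -/
theorem integralExpNeg_le_of_forall {n : ℕ} {α M : ℝ} (hα : 0 < α)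
    (H : ∀ φ ∈ Cvx₀ n, integralExpNeg (gaugeTransform α φ) ≤ ENNReal.ofReal M * integralExpNeg φ)
    {φ : EuclideanSpace ℝ (Fin n) → ℝ≥0∞} (hφ : φ ∈ Cvx₀ n) :
    ENNReal.ofReal ((α ^ n)⁻¹) * integralExpNeg φ ≤
      ENNReal.ofReal M * integralExpNeg (gaugeTransform α φ) := by
  rw [← integralExpNeg_gaugeTransform_gaugeTransform hφ hα]
  exact H _ (gaugeTransform_mem_Cvx₀ φ α)

/-- All sublevel sets of `ψ` at positive levels are dilates of `K`, so `vol K` cancels from the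
ratio; this is why `r`, `t₀` and `γ` do not depend on `K`. -/
theorem psi_extremal {n : ℕ} {α M B r t₀ : ℝ} (hα : 0 < α) (hM : 0 < M) (hB : 0 < B)
    (hr : r ∈ Set.Icc (0 : ℝ) 1) (ht₀ : 0 < t₀)
    (hBeq : ∫⁻ t in Set.Ioi (0 : ℝ), ENNReal.ofReal (Real.exp (-t)) *
        ENNReal.ofReal (levelRadius r t₀ t ^ n) = ENNReal.ofReal B)
    (hMBeq : ∫⁻ t in Set.Ioi (0 : ℝ), ENNReal.ofReal (nuWeight α n t) *
        ENNReal.ofReal (levelRadius r t₀ t ^ n) = ENNReal.ofReal (M * B))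
    (H : ∀ φ ∈ Cvx₀ n, integralExpNeg (gaugeTransform α φ) ≤ ENNReal.ofReal M * integralExpNeg φ)
    (K : ConvexBody (EuclideanSpace ℝ (Fin n)))
    (hK : (0 : EuclideanSpace ℝ (Fin n)) ∈ interior (K : Set (EuclideanSpace ℝ (Fin n)))) :
    (psi K r t₀ ∈ Cvx₀Bar n ∧
      (∀ φ ∈ Cvx₀Bar n, santaloRatio α φ ≤ santaloRatio α (psi K r t₀)) ∧
      santaloRatio α (psi K r t₀) = ENNReal.ofReal M) ∧
    (gaugeTransform α (psi K r t₀) ∈ Cvx₀Bar n ∧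
      (∀ φ ∈ Cvx₀Bar n, santaloRatio α (gaugeTransform α (psi K r t₀)) ≤ santaloRatio α φ) ∧
      santaloRatio α (gaugeTransform α (psi K r t₀)) = ENNReal.ofReal (1 / (M * α ^ n))) := by
  have hψ := psi_mem_Cvx₀ hK hr ht₀
  set V := MeasureTheory.volume (K : Set (EuclideanSpace ℝ (Fin n))) with hV
  have hVtop : V ≠ ⊤ := K.isCompact.measure_lt_top.ne
  have hV0 : V ≠ 0 := ((isOpen_interior.measure_pos _ ⟨0, hK⟩).trans_le
    (MeasureTheory.measure_mono interior_subset)).ne'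
  have hI : integralExpNeg (psi K r t₀) = ENNReal.ofReal B * V := by
    rw [integralExpNeg_eq_lintegral_volume (Cvx₀.measurable hψ),
      lintegral_mul_volume_psi hK hr ht₀ fun t => Real.exp (-t), hBeq]
  have hJ : integralExpNeg (gaugeTransform α (psi K r t₀)) = ENNReal.ofReal (M * B) * V := by
    rw [integralExpNeg_gaugeTransform hψ hα, lintegral_mul_volume_psi hK hr ht₀, hMBeq]
  have hB0 : ENNReal.ofReal B ≠ 0 := by simpa using hB
  have hMB : 0 < M * B := mul_pos hM hB
  have hMB0 : ENNReal.ofReal (M * B) ≠ 0 := by simpa using hMB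
  have hαn : 0 < α ^ n := pow_pos hα n
  have hmax : santaloRatio α (psi K r t₀) = ENNReal.ofReal M := by
    rw [santaloRatio, hI, hJ, ENNReal.mul_div_mul_right _ _ hV0 hVtop,
      ← ENNReal.ofReal_div_of_pos hB, mul_div_cancel_right₀ _ hB.ne']
  have hmin : santaloRatio α (gaugeTransform α (psi K r t₀)) =
      ENNReal.ofReal (1 / (M * α ^ n)) := by
    rw [santaloRatio, integralExpNeg_gaugeTransform_gaugeTransform hψ hα, hI, hJ, ← mul_assoc,
      ENNReal.mul_div_mul_right _ _ hV0 hVtop, ← ENNReal.ofReal_mul (by positivity),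
      ← ENNReal.ofReal_div_of_pos hMB]
    congr 1
    field_simp
  refine ⟨⟨⟨hψ, ?_, ?_⟩, fun φ hφ => ?_, hmax⟩,
    ⟨⟨gaugeTransform_mem_Cvx₀ _ α, ?_, ?_⟩, fun φ hφ => ?_, hmin⟩⟩
  · rw [hI]; exact ENNReal.mul_pos hB0 hV0
  · rw [hI]; exact ENNReal.mul_lt_top ENNReal.ofReal_lt_top hVtop.lt_top
  · rw [hmax]
    exact ENNReal.div_le_of_le_mul (H φ hφ.1)
  · rw [hJ]; exact ENNReal.mul_pos hMB0 hV0
  · rw [hJ]; exact ENNReal.mul_lt_top ENNReal.ofReal_lt_top hVtop.lt_top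
  · rw [hmin, santaloRatio, ENNReal.le_div_iff_mul_le (Or.inl hφ.2.1.ne') (Or.inl hφ.2.2.ne)]
    have h := integralExpNeg_le_of_forall hα H hφ.1
    have hM0 : ENNReal.ofReal M ≠ 0 := by simpa using hM
    rw [← ENNReal.mul_le_mul_iff_right hM0 ENNReal.ofReal_ne_top, ← mul_assoc,
      ← ENNReal.ofReal_mul hM.le]
    have e : M * (1 / (M * α ^ n)) = (α ^ n)⁻¹ := by field_simp
    rwa [e]

end Santalo

end

/-! ### Choice of the constants and conclusion -/

theorem theorem1p2 :
    ∃ C : ℝ, 0 < C ∧ ∃ c : ℝ, 0 < c ∧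
      ∀ (n : ℕ) (hn : 0 < n) (α : ℝ), 1 < α → α < Santalo.rho n hn * ((n : ℝ) + 2) ^ 2 →
        ∃ r ∈ Set.Icc (0 : ℝ) 1, ∃ t₀ : ℝ, 0 < t₀ ∧ ∃ γ : ℝ,
          1 + c / (n : ℝ) ≤ γ ∧
          γ ≤ C * (n : ℝ) * √(n : ℝ) * Real.exp (2 * α / (n : ℝ)) ∧
          ∀ K : ConvexBody (EuclideanSpace ℝ (Fin n)),
            (0 : EuclideanSpace ℝ (Fin n)) ∈ interior (K : Set (EuclideanSpace ℝ (Fin n))) →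
            -- the functions `ψ_{K,r,t₀}` are maximizers
            (Santalo.psi K r t₀ ∈ Santalo.Cvx₀Bar n ∧
              (∀ φ ∈ Santalo.Cvx₀Bar n,
                Santalo.santaloRatio α φ ≤ Santalo.santaloRatio α (Santalo.psi K r t₀)) ∧
              Santalo.santaloRatio α (Santalo.psi K r t₀) =
                ENNReal.ofReal (γ * (n.factorial : ℝ) / α ^ n)) ∧
            -- their transforms are minimizers
            (Santalo.gaugeTransform α (Santalo.psi K r t₀) ∈ Santalo.Cvx₀Bar n ∧
              (∀ φ ∈ Santalo.Cvx₀Bar n,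
                Santalo.santaloRatio α
                  (Santalo.gaugeTransform α (Santalo.psi K r t₀)) ≤ Santalo.santaloRatio α φ) ∧
              Santalo.santaloRatio α (Santalo.gaugeTransform α (Santalo.psi K r t₀)) =
                ENNReal.ofReal (1 / (γ * (n.factorial : ℝ)))) := by
  refine ⟨6, by norm_num, 1 / 320, by norm_num, fun n hn α hα hαρ => ?_⟩
  have hα0 : 0 < α := by linarith
  have hf : (0 : ℝ) < n.factorial := by exact_mod_cast n.factorial_pos
  have hαn : 0 < α ^ n := pow_pos hα0 n
  obtain ⟨t₁, t₂, h1, h12, hsum, hprod, hw⟩ := Santalo.exists_roots hn hα0 hαρ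
  obtain ⟨r, hr, t₀, ht₀, M, B, hM, hB, hBeq, hMBeq, H⟩ :=
    Santalo.exists_maximizer h1 h12 hsum hprod
  -- `w(t₁)` is itself an admissible constant, and `M` is the ratio attained by the extremal
  -- profile.
  have hMw : M ≤ Santalo.weightRatio α n t₁ := by
    have h := Santalo.ratioLE_of_weightRatio_le h1 h12 hsum hprod hw le_rfl
      (Santalo.concaveOn_levelRadius r t₀) fun t ht => (Santalo.levelRadius_pos hr ht₀ ht).le
    have hw0 := (Santalo.weightRatio_pos n hα0 h1).le
    rw [Santalo.RatioLE, hBeq, hMBeq, ← ENNReal.ofReal_mul hw0,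
      ENNReal.ofReal_le_ofReal_iff (mul_nonneg hw0 hB.le)] at h
    exact le_of_mul_le_mul_right h hB
  -- `γ` is `M` normalized so that `γ n! / α^n = M`.
  refine ⟨r, hr, t₀, ht₀, M * α ^ n / n.factorial,
    Santalo.one_add_le_of_ratioLE hn hα.le hM H, ?_, fun K hK => ?_⟩
  · refine le_trans ?_ (Santalo.weightRatio_mul_le hn h1 h12 hsum hprod hα.le)
    gcongr
  · have e1 : M * α ^ n / n.factorial * n.factorial = M * α ^ n := div_mul_cancel₀ _ hf.ne'
    have e2 : M * α ^ n / α ^ n = M := mul_div_cancel_right₀ _ hαn.ne'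
    rw [e1, e2]
    exact Santalo.psi_extremal hα0 hM hB hr ht₀ hBeq hMBeq
      (fun φ hφ => Santalo.integralExpNeg_gaugeTransform_le hn hφ hα0 hM H) K hK
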